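/- Let $K$ be a field of characteristic $0$ and let $A$ be a finite-dimensional (left) Leibniz algebra over $K$, i.e. a finite-dimensional $K$-vector space with a bilinear product satisfying $x(yz) = (xy)z + y(xz)$ for all $x,y,z \in A$. Let the Frattini subalgebra $F(A)$ be the intersection of all maximal proper subalgebras of $A$ (with $F(A)=A$ if there are none), and let the Frattini ideal $\Phi(A)$ be the largest two-sided ideal of $A$ contained in $F(A)$. Then $F(A)$ is a two-sided ideal of $A$; hence $F(A) = \Phi(A)$. -/

import Mathlib

/-- A (left) Leibniz algebra: a not necessarily associative algebra in which every left
multiplication is a derivation, i.e. `x(yz) = (xy)z + y(xz)`. -/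
class IsLeibniz (A : Type*) [NonUnitalNonAssocRing A] : Prop where
  leibniz : ∀ x y z : A, x * (y * z) = (x * y) * z + y * (x * z)

namespace Leibniz

section

variable (K : Type*) {A : Type*} [Field K] [NonUnitalNonAssocRing A] [Module K A]

/-- A linear subspace is a (two-sided) ideal if it absorbs products on both sides. -/
def IsIdeal {K : Type*} {A : Type*} [Field K] [NonUnitalNonAssocRing A] [Module K A]
    (I : Submodule K A) : Prop :=
  ∀ a : A, ∀ x ∈ I, a * x ∈ I ∧ x * a ∈ I

variable (A) [IsScalarTower K A A] [SMulCommClass K A A]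

/-- The Frattini subalgebra `F(A)`: the intersection of all maximal (proper) subalgebras of `A`
(and `A` itself if there are none). -/
noncomputable def frattiniSubalgebra : NonUnitalSubalgebra K A :=
  sInf {M : NonUnitalSubalgebra K A | IsCoatom M}

/-- The Frattini ideal `Φ(A)`: the largest ideal of `A` contained in `F(A)`, constructed as the
sum of all such ideals. -/
noncomputable def frattiniIdeal : Submodule K A :=
  sSup {I : Submodule K A | IsIdeal I ∧ I ≤ (frattiniSubalgebra K A).toSubmodule}

/-- `Φ(A)` is indeed the largest ideal contained in `F(A)`. -/
theorem isGreatest_frattiniIdeal :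
    IsGreatest {I : Submodule K A | IsIdeal I ∧ I ≤ (frattiniSubalgebra K A).toSubmodule}
      (frattiniIdeal K A) := by
  refine ⟨⟨fun a x hx => ?_, sSup_le fun I hI => hI.2⟩, fun I hI => le_sSup hI⟩
  have hl : frattiniIdeal K A ≤ (frattiniIdeal K A).comap (LinearMap.mulLeft K a) :=
    sSup_le fun I hI y hy => (le_sSup hI : I ≤ frattiniIdeal K A) (hI.1 a y hy).1
  have hr : frattiniIdeal K A ≤ (frattiniIdeal K A).comap (LinearMap.mulRight K a) :=
    sSup_le fun I hI y hy => (le_sSup hI : I ≤ frattiniIdeal K A) (hI.1 a y hy).2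
  exact ⟨hl hx, hr hx⟩

end

end Leibniz

/-!
The Frattini subalgebra `F(A)` is contained in each maximal subalgebra `M`; it is an ideal because
it is contained even in the core of `M`, the largest ideal inside `M`
(`Leibniz.frattiniSubalgebra_le_core`). Then `F(A)` is the intersection of these cores.

Since maximal subalgebras pull back along surjective homomorphisms, `F` maps into `F` under such
homomorphisms (`Leibniz.map_mem_frattiniSubalgebra`). Dividing by the core, one may assume that `M`
contains no nonzero ideal, and has to show that `F(A) = 0`. Let `B` be a minimal nonzero abelian
ideal, if there is one. As `M` does not contain it, `A = M ⊕ B`. The elements of `B` that annihilate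
`A` from the left form an ideal, so there are two cases.

* None but zero does. Squares annihilate from the left, so left and right multiplications agree on
  `B` up to sign. The automorphisms `1 - L_b`, for `b ∈ B`, preserve `F(A)`, so `b x ∈ M ∩ B = 0`
  for `x ∈ F(A)`. Thus `F(A)` lies in the centralizer of `B` in `M`, an ideal of `A` inside `M`.
* All of `B` does. Then `M` acts faithfully and irreducibly on `B`, squares vanish in `M`, and the
  projection `A → M` along `B` is a homomorphism. So it suffices that the maximal subalgebras of
  the Lie algebra `M` intersect trivially.

If there is no such `B`, then in particular the left annihilator of `A`, which contains all squares,
is zero, and `A` is a semisimple Lie algebra. It remains to treat the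
intersection of the maximal subalgebras of two kinds of Lie algebras `L`.

For `L` semisimple (`LieAlgebra.eq_zero_of_forall_mem_coatom_of_isKilling`), mapping to the simple
quotients reduces to `L` simple. There every nonzero `f` belongs to a generating pair `x, f`
(`LieAlgebra.exists_lieSpan_pair_eq_top_of_isKilling`); if `f` lay in all maximal subalgebras, then
`x` alone would generate `L`, which would be abelian. The generating pair is first found over the
algebraic closure: let `h` be an element of a Cartan subalgebra at which the roots take distinct
nonzero values. Any element having a nonzero component in each root space generates `L` together
with `h`. Some automorphism moves `f` to such an element: if an automorphic image of `f` with the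
most nonzero root components lacked one, then, the one-parameter groups `exp (t ad e)` being
polynomial in `t`, the images of `f` with these same components would span an ideal inside a proper
subspace (`LieAlgebra.exists_equiv_components`). The pair descends to the ground field, since for
fixed `f` a Zariski open condition on `x`, defined over the ground field, expresses generation
(`LieAlgebra.exists_lieSpan_pair_eq_top_of_extension`).

For `L` with a faithful irreducible representation
(`LieAlgebra.eq_zero_of_forall_mem_coatom_of_isIrreducible`), a trace argument shows that the
radical meets `[L, L]` trivially (`LieAlgebra.radical_inf_lie_top_top_eq_bot`). An
element of all maximal subalgebras lies in the radical, by the semisimple case applied to the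
quotient by the radical, and in `[L, L]`, since hyperplanes containing `[L, L]` are maximal
subalgebras.
-/

namespace LieAlgebra

open Module Module.End LieModule Polynomial

/-! ### One-parameter groups of automorphisms -/

section OneParameter

variable {E L : Type*} [Field E] [CharZero E] [LieRing L] [LieAlgebra E L]

/-- An `ad`-nilpotent element `e` gives the one-parameter group `t ↦ exp (t • ad e)` of
automorphisms. Its matrix coefficients are polynomials in `t`, and the derivative at `t = 0` is
`ad e`. -/
lemma exists_oneParameter_of_isNilpotent_ad {e : L} (he : _root_.IsNilpotent (ad E L e)) :
    ∃ g : E → (L ≃ₗ⁅E⁆ L), ∀ (u : L) (φ : Dual E L), ∃ p : E[X],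
      (∀ t, p.eval t = φ (g t u)) ∧ p.coeff 0 = φ u ∧ p.coeff 1 = φ ⁅e, u⁆ := by
  -- The exponential of a nilpotent derivation is stated in terms of a `ℚ`-algebra structure.
  let _ : Module ℚ L := Module.compHom L (algebraMap ℚ E)
  have hQ (q : ℚ) (x : L) : q • x = (q : E) • x := rfl
  let _ : LieAlgebra ℚ L := { lie_smul := fun t x y ↦ by simp only [hQ, lie_smul] }
  have hD (t : E) : _root_.IsNilpotent (t • LieDerivation.ad E L e).toLinearMap := by
    have : (t • LieDerivation.ad E L e).toLinearMap = t • ad E L e := by ext; simp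
    rw [this]
    exact he.smul t
  obtain ⟨n, hn⟩ := he
  -- Summing beyond `n` makes the terms of degree `0` and `1` appear in every case.
  refine ⟨fun t ↦ LieDerivation.exp _ (hD t), fun u φ ↦
    ⟨∑ k ∈ Finset.range (n + 2), Polynomial.C ((k.factorial : E)⁻¹ * φ ((ad E L e ^ k) u)) * X ^ k,
      fun t ↦ ?_, ?_, ?_⟩⟩
  · have h0 : (t • LieDerivation.ad E L e).toLinearMap ^ (n + 2) = 0 := by
      have : (t • LieDerivation.ad E L e).toLinearMap = t • ad E L e := by ext; simp
      rw [this, _root_.smul_pow, pow_add (ad E L e), hn, zero_mul, smul_zero]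
    have h1 : (t • LieDerivation.ad E L e).toLinearMap = t • ad E L e := by ext; simp
    rw [LieDerivation.exp_map_apply, IsNilpotent.exp_eq_sum h0, h1]
    simp only [eval_finsetSum, eval_mul, eval_C, eval_pow, eval_X, _root_.smul_pow,
      LinearMap.sum_apply, map_sum]
    refine Finset.sum_congr rfl fun k _ ↦ ?_
    rw [LinearMap.smul_apply, hQ, LinearMap.smul_apply, map_smul, map_smul]
    simp only [smul_eq_mul]
    push_cast
    ring
  all_goals simp only [finsetSum_coeff, coeff_C_mul, coeff_X_pow]; simp

end OneParameter

/-! ### Generation by a diagonalizable element and its eigenvectors -/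

section Generation

variable {E L : Type*} [Field E] [LieRing L] [LieAlgebra E L]

/-- Elements normalizing a subspace form a subalgebra; if they include a generating set then the
subspace is an ideal. -/
lemma lie_mem_of_lieSpan_eq_top {s : Set L} (hs : LieSubalgebra.lieSpan E L s = ⊤)
    (Y : Submodule E L) (hY : ∀ e ∈ s, ∀ y ∈ Y, ⁅e, y⁆ ∈ Y) (x : L) {y : L} (hy : y ∈ Y) :
    ⁅x, y⁆ ∈ Y := by
  have hx : x ∈ LieSubalgebra.lieSpan E L s := hs ▸ LieSubalgebra.mem_top x
  induction hx using LieSubalgebra.lieSpan_induction generalizing y with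
  | mem u hu => exact hY u hu y hy
  | zero => simp
  | add u v _ _ hu hv => rw [add_lie]; exact Y.add_mem (hu hy) (hv hy)
  | smul t u _ hu => rw [smul_lie]; exact Y.smul_mem t (hu hy)
  | lie u v _ _ hu hv => rw [lie_lie]; exact Y.sub_mem (hu (hv hy)) (hv (hu hy))

variable [FiniteDimensional E L]

/-- If `ad h` is diagonalizable with one-dimensional eigenspaces for its nonzero eigenvalues, then
any `u` having a component in each of these eigenspaces generates them all, together with `h`. -/
lemma lieSpan_pair_eq_top_of_components {h u : L}
    (hss : ⨆ μ, (ad E L h).eigenspace μ = ⊤)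
    (hone : ∀ μ ≠ 0, ∀ a ∈ (ad E L h).eigenspace μ, a ≠ 0 →
      (ad E L h).eigenspace μ ≤ Submodule.span E {a})
    (hgen : LieSubalgebra.lieSpan E L (⋃ μ ∈ ({0}ᶜ : Set E), ((ad E L h).eigenspace μ : Set L)) = ⊤)
    (hu : ∀ μ ≠ 0, (ad E L h).eigenspace μ ≠ ⊥ → u ∉ ⨆ ν ≠ μ, (ad E L h).eigenspace ν) :
    LieSubalgebra.lieSpan E L {h, u} = ⊤ := by
  set S := LieSubalgebra.lieSpan E L {h, u}
  have hhS : h ∈ S := LieSubalgebra.subset_lieSpan (by simp)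
  have huS : u ∈ S := LieSubalgebra.subset_lieSpan (by simp)
  have hdec := Submodule.eq_iSup_inf_genEigenspace (p := S.toSubmodule) (f := ad E L h) 1
    (fun x hx ↦ S.lie_mem hhS hx) hss
  rw [eq_top_iff, ← hgen, LieSubalgebra.lieSpan_le]
  simp only [Set.iUnion_subset_iff]
  intro μ hμ a ha
  by_cases hbot : (ad E L h).eigenspace μ = ⊥
  · have : a = 0 := by simpa [hbot] using ha
    rw [this]; exact S.zero_mem
  have hμS : S.toSubmodule ⊓ (ad E L h).eigenspace μ ≠ ⊥ := by
    intro h0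
    apply hu μ hμ hbot
    have huS' : u ∈ S.toSubmodule := huS
    rw [hdec] at huS'
    refine (iSup_le fun ν ↦ ?_ : _ ≤ (⨆ ν ≠ μ, (ad E L h).eigenspace ν)) huS'
    by_cases hν : ν = μ
    · subst hν
      exact h0.le.trans bot_le
    · exact inf_le_right.trans (le_iSup₂_of_le ν hν le_rfl)
  obtain ⟨b, ⟨hbS, hb⟩, hb0⟩ := Submodule.exists_mem_ne_zero_of_ne_bot hμS
  obtain ⟨c, rfl⟩ := Submodule.mem_span_singleton.mp (hone μ hμ b hb hb0 ha)
  exact S.smul_mem c hbS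

variable [CharZero E]

/-- If `ad h` is diagonalizable with its nonzero eigenspaces consisting of `ad`-nilpotent elements
and generating `L`, and `f` generates `L` as an ideal, then some automorphism moves `f` to an
element with a component in each of these eigenspaces. -/
lemma exists_equiv_components {h f : L}
    (hnil : ∀ μ ≠ 0, ∀ a ∈ (ad E L h).eigenspace μ, _root_.IsNilpotent (ad E L a))
    (hgen : LieSubalgebra.lieSpan E L (⋃ μ ∈ ({0}ᶜ : Set E), ((ad E L h).eigenspace μ : Set L)) = ⊤)
    (hf : LieSubmodule.lieSpan E L {f} = ⊤) :
    ∃ g : L ≃ₗ⁅E⁆ L, ∀ μ ≠ 0, (ad E L h).eigenspace μ ≠ ⊥ →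
      g f ∉ ⨆ ν ≠ μ, (ad E L h).eigenspace ν := by
  classical
  let W : E → Submodule E L := fun μ ↦ ⨆ ν ≠ μ, (ad E L h).eigenspace ν
  let bad : L → Set E := fun u ↦ {μ | μ ≠ 0 ∧ (ad E L h).eigenspace μ ≠ ⊥ ∧ u ∈ W μ}
  have hfin : {μ : E | (ad E L h).eigenspace μ ≠ ⊥}.Finite :=
    WellFoundedGT.finite_ne_bot_of_iSupIndep (ad E L h).eigenspaces_iSupIndep
  have hbadfin (u : L) : (bad u).Finite := hfin.subset fun μ hμ ↦ hμ.2.1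
  -- An automorphism for which the number of missing components is as small as possible.
  obtain ⟨g, hg⟩ : ∃ g : L ≃ₗ⁅E⁆ L, ∀ g' : L ≃ₗ⁅E⁆ L, (bad (g f)).ncard ≤ (bad (g' f)).ncard := by
    obtain ⟨g, -, hg⟩ := WellFounded.has_min
      (InvImage.wf (fun g : L ≃ₗ⁅E⁆ L ↦ (bad (g f)).ncard) wellFounded_lt) Set.univ
      ⟨LieEquiv.refl, trivial⟩
    exact ⟨g, fun g' ↦ not_lt.mp (hg g' trivial)⟩
  refine ⟨g, fun μ hμ hbot hmem ↦ ?_⟩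
  have hμbad : μ ∈ bad (g f) := ⟨hμ, hbot, hmem⟩
  let X : Set L := {u | bad u = bad (g f) ∧ ∃ g' : L ≃ₗ⁅E⁆ L, u = g' f}
  let Y : Submodule E L := Submodule.span E X
  have hYW : Y ≤ W μ := Submodule.span_le.mpr fun u hu ↦ by
    have : μ ∈ bad u := by rw [hu.1]; exact hμbad
    exact this.2.2
  -- Minimality makes the span of `X` stable under the infinitesimal generators.
  have hstab : ∀ e ∈ ⋃ ν ∈ ({0}ᶜ : Set E), ((ad E L h).eigenspace ν : Set L),
      ∀ y ∈ Y, ⁅e, y⁆ ∈ Y := by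
    intro e he
    simp only [Set.mem_iUnion] at he
    obtain ⟨ν, hν, he⟩ := he
    obtain ⟨γ, hγ⟩ := exists_oneParameter_of_isNilpotent_ad (hnil ν hν e he)
    suffices ∀ u ∈ X, ⁅e, u⁆ ∈ Y from fun y hy ↦
      (Submodule.span_le.mpr this : Y ≤ Y.comap (ad E L e)) hy
    intro u hu
    -- Components which are present at `t = 0` are present for almost all `t`.
    have hX : ∀ᶠ t in Filter.cofinite, γ t u ∈ X := by
      have h1 : ∀ᶠ t in Filter.cofinite, ∀ κ ∈ {μ : E | (ad E L h).eigenspace μ ≠ ⊥},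
          u ∉ W κ → γ t u ∉ W κ := by
        rw [Filter.eventually_all_finite hfin]
        intro κ _
        by_cases hw : u ∈ W κ
        · exact Filter.Eventually.of_forall fun t h ↦ absurd hw h
        obtain ⟨φ, hφ, hφW⟩ := Submodule.exists_le_ker_of_notMem hw
        obtain ⟨p, hp, hp0, -⟩ := hγ u φ
        have hpne : p ≠ 0 := fun h0 ↦ hφ (by rw [← hp0, h0, coeff_zero])
        refine (Polynomial.finite_setOfPred_isRoot hpne).subset fun t ht ↦ ?_
        have ht : γ t u ∈ W κ := by simpa [hw] using ht
        exact (hp t).trans (hφW ht)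
      refine h1.mono fun t ht ↦ ?_
      obtain ⟨g', rfl⟩ := hu.2
      refine ⟨?_, g'.trans (γ t), rfl⟩
      have hsub : bad (γ t (g' f)) ⊆ bad (g f) := by
        rw [← hu.1]
        exact fun κ h' ↦ ⟨h'.1, h'.2.1, by_contra fun h'' ↦ ht κ h'.2.1 h'' h'.2.2⟩
      exact Set.eq_of_subset_of_ncard_le hsub (hg (g'.trans (γ t))) (hbadfin _)
    -- A functional vanishing on `X` vanishes at `γ t u` for almost all `t`, hence at `⁅e, u⁆`.
    by_contra hnot
    obtain ⟨ψ, hψ, hψY⟩ := Submodule.exists_le_ker_of_notMem hnot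
    obtain ⟨p, hp, -, hp1⟩ := hγ u ψ
    have hp0 : p = 0 := by
      by_contra hpne
      have hfin' := Polynomial.finite_setOfPred_isRoot hpne
      have : ∀ᶠ t in Filter.cofinite, p.IsRoot t :=
        hX.mono fun t ht ↦ (hp t).trans (hψY (Submodule.subset_span ht))
      exact Set.infinite_univ (α := E) ((hfin'.union this).subset fun t _ ↦ em _)
    exact hψ (by rw [← hp1, hp0, coeff_zero])
  have hideal := fun x {y} (hy : y ∈ Y) ↦ lie_mem_of_lieSpan_eq_top hgen Y hstab x hy
  -- Hence this span is an ideal containing `g f`, so it is everything.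
  have hYtop : Y = ⊤ := by
    let I : LieIdeal E L :=
      { Y.comap (g : L →ₗ[E] L) with
        lie_mem := fun {x y} hy ↦ by
          change g ⁅x, y⁆ ∈ Y
          rw [LieEquiv.map_lie]
          exact hideal _ hy }
    have hI : I = ⊤ := by
      rw [eq_top_iff, ← hf, LieSubmodule.lieSpan_le, Set.singleton_subset_iff]
      exact Submodule.subset_span ⟨rfl, g, rfl⟩
    rw [eq_top_iff]
    intro y _
    have : g.symm y ∈ I := hI ▸ LieSubmodule.mem_top _
    have : g (g.symm y) ∈ Y := this
    simpa using this
  have hWtop : W μ = ⊤ := top_le_iff.mp (hYtop ▸ hYW)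
  have := (ad E L h).eigenspaces_iSupIndep μ
  rw [show (⨆ j, ⨆ (_ : j ≠ μ), (ad E L h).eigenspace j) = ⊤ from hWtop] at this
  exact hbot (disjoint_top.mp this)

end Generation

end LieAlgebra

namespace LieAlgebra

open Module Module.End LieModule

/-! ### Generating pairs over an algebraically closed field -/

section SplitElement

/-- If subspaces of eigenspaces already span the whole space, then they are the eigenspaces. -/
lemma eigenspace_eq_of_le_of_iSup_eq_top {E V : Type*} [Field E] [AddCommGroup V] [Module E V]
    (f : End E V) (N : E → Submodule E V) (hN : ∀ μ, N μ ≤ f.eigenspace μ) (htop : ⨆ μ, N μ = ⊤)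
    (μ : E) : f.eigenspace μ = N μ := by
  refine le_antisymm ?_ (hN μ)
  have hle : (⨆ ν, N ν) ≤ N μ ⊔ ⨆ ν ≠ μ, f.eigenspace ν := iSup_le fun ν ↦ by
    by_cases hν : ν = μ
    · exact hν ▸ le_sup_left
    · have h0 : f.eigenspace ν ≤ ⨆ κ ≠ μ, f.eigenspace κ := le_iSup₂_of_le ν hν le_rfl
      exact (hN ν).trans (h0.trans le_sup_right)
  have h1 : f.eigenspace μ ≤ (N μ ⊔ ⨆ ν ≠ μ, f.eigenspace ν) ⊓ f.eigenspace μ :=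
    le_inf (le_top.trans (htop ▸ hle)) le_rfl
  rw [sup_inf_assoc_of_le _ (hN μ), inf_comm, (f.eigenspaces_iSupIndep μ).eq_bot, sup_bot_eq] at h1
  exact h1

variable {E L : Type*} [Field E] [CharZero E] [LieRing L] [LieAlgebra E L]
  [FiniteDimensional E L] [IsKilling E L]

open IsKilling

/-- A split semisimple Lie algebra is generated by its root spaces. -/
lemma lieSubalgebra_eq_top_of_rootSpace_le (H : LieSubalgebra E L) [H.IsCartanSubalgebra]
    [IsTriangularizable E H L] (S : LieSubalgebra E L)
    (hS : ∀ α : Weight E H L, α.IsNonZero → (rootSpace H α).toSubmodule ≤ S.toSubmodule) :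
    S = ⊤ := by
  have hHS : H ≤ S := by
    intro x hx
    have hx' : (⟨x, hx⟩ : H) ∈ (⨆ α : Weight E H L, ⨆ (_ : α.IsNonZero), corootSpace α) := by
      rw [biSup_corootSpace_eq_top]; trivial
    let Q : Submodule E H := S.toSubmodule.comap H.toSubmodule.subtype
    suffices h : (⨆ α : Weight E H L, ⨆ (_ : α.IsNonZero), corootSpace α).toSubmodule ≤ Q from h hx'
    simp only [LieSubmodule.iSup_toSubmodule, iSup_le_iff]
    intro α hα y hy
    have hy' := (mem_corootSpace α).mp (show y ∈ corootSpace α from hy)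
    suffices h : Submodule.span E {⁅y, z⁆ | (y ∈ rootSpace H α) (z ∈ rootSpace H (-α))} ≤
      S.toSubmodule from h hy'
    rw [Submodule.span_le]
    rintro _ ⟨a, ha, c, hc, rfl⟩
    exact S.lie_mem (hS α hα ha) (hS (-α) (Weight.isNonZero_neg.mpr hα) hc)
  have htop := congrArg LieSubmodule.toSubmodule (iSup_genWeightSpace_eq_top' E H L)
  rw [LieSubmodule.iSup_toSubmodule, LieSubmodule.top_toSubmodule] at htop
  rw [eq_top_iff]
  intro x _
  have hx : x ∈ (⨆ χ : Weight E H L, (genWeightSpace L χ).toSubmodule) := htop ▸ trivial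
  refine (iSup_le fun χ ↦ ?_ : _ ≤ S.toSubmodule) hx
  by_cases hχ : χ.IsZero
  · intro y hy
    apply hHS
    have hy : y ∈ rootSpace H (χ : H → E) := hy
    rw [show (χ : H → E) = 0 from hχ, rootSpace_zero_eq] at hy
    exact hy
  · exact hS χ hχ

/-- A semisimple Lie algebra over an algebraically closed field has an element whose adjoint action
is diagonalizable with one-dimensional eigenspaces for its nonzero eigenvalues, these eigenspaces
consisting of `ad`-nilpotent elements and generating the Lie algebra. It is found in a Cartan
subalgebra, off the hyperplanes where a root vanishes or two roots agree. -/
lemma exists_split_element [IsAlgClosed E] : ∃ h : L,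
    ⨆ μ, (ad E L h).eigenspace μ = ⊤ ∧
    (∀ μ ≠ 0, ∀ a ∈ (ad E L h).eigenspace μ, a ≠ 0 →
      (ad E L h).eigenspace μ ≤ Submodule.span E {a}) ∧
    (∀ μ ≠ 0, ∀ a ∈ (ad E L h).eigenspace μ, _root_.IsNilpotent (ad E L a)) ∧
    LieSubalgebra.lieSpan E L (⋃ μ ∈ ({0}ᶜ : Set E), ((ad E L h).eigenspace μ : Set L)) = ⊤ := by
  obtain ⟨x₀, hx₀⟩ := exists_isCartanSubalgebra_engel E L
  set H := LieSubalgebra.engel E x₀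
  let T : Set (Dual E H) := insert 0 (Set.range (Weight.toLinear E H L))
  have hT : T.Finite := (Set.finite_range _).insert 0
  have := hT.to_subtype
  obtain ⟨h, hh⟩ := Module.Dual.exists_forall_ne_zero_of_forall_exists
    (fun p : {p : T × T // p.1 ≠ p.2} ↦ (p.1.1.1 - p.1.2.1 : Dual E H)) (fun p ↦ by
      by_contra! hp
      exact p.2 (Subtype.ext (sub_eq_zero.mp (LinearMap.ext hp))))
  have hinj : ∀ α β : Weight E H L, α h = β h → α = β := by
    intro α β hαβ
    by_contra hne
    refine hh ⟨(⟨α.toLinear, by simp [T]⟩, ⟨β.toLinear, by simp [T]⟩), fun h' ↦ hne ?_⟩ ?_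
    · have h'' : α.toLinear = β.toLinear := congrArg Subtype.val h'
      exact DFunLike.ext _ _ fun y ↦ congrArg (fun f : Dual E H ↦ f y) h''
    · simpa [sub_eq_zero] using hαβ
  have hzero : ∀ α : Weight E H L, α.IsNonZero → α h ≠ 0 := by
    intro α hα hαh
    refine hh ⟨(⟨α.toLinear, by simp [T]⟩, ⟨0, by simp [T]⟩), fun h' ↦ hα ?_⟩ ?_
    · have h'' : α.toLinear = 0 := congrArg Subtype.val h'
      exact funext fun y ↦ congrArg (fun f : Dual E H ↦ f y) h''
    · simpa using hαh
  have hle (α : Weight E H L) :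
      (rootSpace H α).toSubmodule ≤ (ad E L h).eigenspace (α h) := fun y hy ↦ by
    rw [mem_eigenspace_iff]
    exact lie_eq_smul_of_mem_rootSpace hy h
  have htop := congrArg LieSubmodule.toSubmodule (iSup_genWeightSpace_eq_top' E H L)
  rw [LieSubmodule.iSup_toSubmodule, LieSubmodule.top_toSubmodule] at htop
  have hspan : ⨆ μ, (ad E L h).eigenspace μ = ⊤ := by
    rw [eq_top_iff, ← htop]
    exact iSup_le fun α ↦ (hle α).trans (le_iSup (fun μ ↦ (ad E L h).eigenspace μ) (α h))
  have heig (μ : E) := eigenspace_eq_of_le_of_iSup_eq_top (ad E L h)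
    (fun μ ↦ ⨆ (α : Weight E H L) (_ : α h = μ), (rootSpace H α).toSubmodule)
    (fun μ ↦ iSup₂_le fun α hα ↦ hα ▸ hle α)
    (by
      rw [eq_top_iff, ← htop]
      exact iSup_le fun α ↦ le_iSup_of_le (α h) (le_iSup₂_of_le α rfl le_rfl)) μ
  -- Each nonzero eigenspace is a root space.
  have hroot : ∀ μ ≠ 0, ∀ a ∈ (ad E L h).eigenspace μ, a ≠ 0 → ∃ α : Weight E H L, α.IsNonZero ∧
      (ad E L h).eigenspace μ = (rootSpace H α).toSubmodule := by
    intro μ hμ a ha ha0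
    by_cases hex : ∃ α : Weight E H L, α h = μ
    · obtain ⟨α, rfl⟩ := hex
      refine ⟨α, fun h0 ↦ hμ (congrFun h0 h), ?_⟩
      rw [heig]
      refine le_antisymm (iSup₂_le fun β hβ ↦ hinj β α hβ ▸ le_rfl) (le_iSup₂_of_le α rfl le_rfl)
    · rw [heig] at ha
      refine absurd ?_ ha0
      have hbot : (⨆ (α : Weight E H L) (_ : α h = μ), (rootSpace H α).toSubmodule) = ⊥ := by
        rw [eq_bot_iff]
        exact iSup₂_le fun β hβ ↦ absurd ⟨β, hβ⟩ hex
      simpa [hbot] using ha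
  refine ⟨h, hspan, fun μ hμ a ha ha0 ↦ ?_, fun μ hμ a ha ↦ ?_, ?_⟩
  · obtain ⟨α, hα, hα'⟩ := hroot μ hμ a ha ha0
    have h1 := finrank_rootSpace_eq_one α hα
    have ha' : a ∈ rootSpace H α := by rw [hα'] at ha; exact ha
    rw [hα']
    intro y hy
    obtain ⟨c, hc⟩ := (finrank_eq_one_iff_of_nonzero' (⟨a, ha'⟩ : rootSpace H α)
      (fun h0 ↦ ha0 (congrArg Subtype.val h0))).mp h1 ⟨y, hy⟩
    exact Submodule.mem_span_singleton.mpr ⟨c, congrArg Subtype.val hc⟩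
  · by_cases ha0 : a = 0
    · simp [ha0]
    obtain ⟨α, hα, hα'⟩ := hroot μ hμ a ha ha0
    rw [hα'] at ha
    exact isNilpotent_ad_of_mem_rootSpace H (χ := α) hα ha
  · refine lieSubalgebra_eq_top_of_rootSpace_le H _ fun α hα ↦ ?_
    refine fun y hy ↦ LieSubalgebra.subset_lieSpan ?_
    simp only [Set.mem_iUnion]
    exact ⟨α h, hzero α hα, hle α hy⟩

/-- In a semisimple Lie algebra over an algebraically closed field, every element which generates
the whole algebra as an ideal belongs to a generating pair. -/
lemma exists_lieSpan_pair_eq_top [IsAlgClosed E] {f : L} (hf : LieSubmodule.lieSpan E L {f} = ⊤) :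
    ∃ x : L, LieSubalgebra.lieSpan E L {x, f} = ⊤ := by
  obtain ⟨h, hss, hone, hnil, hgen⟩ := exists_split_element (E := E) (L := L)
  obtain ⟨g, hg⟩ := exists_equiv_components hnil hgen hf
  have htop := lieSpan_pair_eq_top_of_components hss hone hgen hg
  refine ⟨g.symm h, ?_⟩
  have hle : LieSubalgebra.lieSpan E L {h, g f} ≤
      (LieSubalgebra.lieSpan E L {g.symm h, f}).comap (g.symm : L →ₗ⁅E⁆ L) := by
    rw [LieSubalgebra.lieSpan_le]
    rintro y (rfl | rfl)
    · exact LieSubalgebra.subset_lieSpan (by simp)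
    · refine LieSubalgebra.subset_lieSpan ?_
      simp
  rw [htop] at hle
  rw [eq_top_iff]
  intro y _
  have : g.symm (g y) ∈ LieSubalgebra.lieSpan E L {g.symm h, f} := hle (LieSubalgebra.mem_top (g y))
  simpa using this

end SplitElement

end LieAlgebra

namespace LieAlgebra

open Module LieModule
open scoped TensorProduct

/-! ### Bracketed words and Zariski density of generating pairs -/

section Words

/-- The value of a bracketed word in two letters, at the elements `x` (the letter `true`) and `f`
(the letter `false`) of a Lie ring. -/
def evalWord {L : Type*} [LieRing L] (x f : L) : FreeMagma Bool → L
  | .of true => x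
  | .of false => f
  | .mul v w => ⁅evalWord x f v, evalWord x f w⁆

lemma toSubmodule_lieSpan_pair_eq_span_evalWord {E L : Type*} [CommRing E] [LieRing L]
    [LieAlgebra E L] (x f : L) :
    (LieSubalgebra.lieSpan E L {x, f}).toSubmodule =
      Submodule.span E (Set.range (evalWord x f)) := by
  apply le_antisymm
  · have key : ∀ a ∈ Submodule.span E (Set.range (evalWord x f)),
        ∀ c ∈ Submodule.span E (Set.range (evalWord x f)),
        ⁅a, c⁆ ∈ Submodule.span E (Set.range (evalWord x f)) := by
      intro a ha c hc
      induction ha, hc using Submodule.span_induction₂ with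
      | mem_mem a c ha hc =>
        obtain ⟨v, rfl⟩ := ha
        obtain ⟨w, rfl⟩ := hc
        exact Submodule.subset_span ⟨v.mul w, rfl⟩
      | zero_left => simp
      | zero_right => simp
      | add_left _ _ _ _ _ _ h₁ h₂ => rw [add_lie]; exact add_mem h₁ h₂
      | add_right _ _ _ _ _ _ h₁ h₂ => rw [lie_add]; exact add_mem h₁ h₂
      | smul_left t _ _ _ _ h => rw [smul_lie]; exact Submodule.smul_mem _ t h
      | smul_right t _ _ _ _ h => rw [lie_smul]; exact Submodule.smul_mem _ t h
    let S : LieSubalgebra E L :=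
      { Submodule.span E (Set.range (evalWord x f)) with
        lie_mem' := fun {a c} ha hc ↦ key a ha c hc }
    have hS : LieSubalgebra.lieSpan E L {x, f} ≤ S := by
      rw [LieSubalgebra.lieSpan_le]
      rintro y (rfl | rfl)
      · exact Submodule.subset_span ⟨.of true, rfl⟩
      · exact Submodule.subset_span ⟨.of false, rfl⟩
    exact hS
  · rw [Submodule.span_le]
    rintro _ ⟨w, rfl⟩
    induction w with
    | ih1 l => cases l <;> exact LieSubalgebra.subset_lieSpan (by simp [evalWord])
    | ih2 v w hv hw => exact LieSubalgebra.lie_mem _ hv hw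

variable {K L ι : Type*} [Field K] [LieRing L] [LieAlgebra K L] [Fintype ι]

open MvPolynomial in
/-- The coordinates of a bracketed word in a generic element and a fixed element `f`, as polynomials
in the coordinates of the generic element. -/
noncomputable def wordPoly (b : Module.Basis ι K L) (f : L) : FreeMagma Bool → ι → MvPolynomial ι K
  | .of true => X
  | .of false => fun k ↦ C (b.repr f k)
  | .mul v w => fun k ↦
      ∑ i, ∑ j, wordPoly b f v i * wordPoly b f w j * C (b.repr ⁅b i, b j⁆ k)

/-- The polynomials `wordPoly` compute words in any Lie algebra having the same structure
constants as `L`, such as an extension of scalars of `L`. -/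
lemma repr_evalWord {S L' : Type*} [CommRing S] [Algebra K S] [LieRing L'] [LieAlgebra S L']
    (b : Module.Basis ι K L) (b' : Module.Basis ι S L')
    (hb : ∀ i j k, b'.repr ⁅b' i, b' j⁆ k = algebraMap K S (b.repr ⁅b i, b j⁆ k))
    (f : L) (x' f' : L') (hf : ∀ k, b'.repr f' k = algebraMap K S (b.repr f k))
    (w : FreeMagma Bool) (k : ι) :
    b'.repr (evalWord x' f' w) k =
      MvPolynomial.aeval (fun i ↦ b'.repr x' i) (wordPoly b f w k) := by
  induction w generalizing k with
  | ih1 l => cases l <;> simp [evalWord, wordPoly, hf]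
  | ih2 v w hv hw =>
    change b'.repr ⁅evalWord x' f' v, evalWord x' f' w⁆ k =
      MvPolynomial.aeval (fun i ↦ b'.repr x' i)
        (∑ i, ∑ j, wordPoly b f v i * wordPoly b f w j * MvPolynomial.C (b.repr ⁅b i, b j⁆ k))
    conv_lhs => rw [← b'.sum_repr (evalWord x' f' v), ← b'.sum_repr (evalWord x' f' w)]
    simp only [sum_lie, lie_sum,
      smul_lie, lie_smul, map_sum, map_smul, Finsupp.coe_finsetSum,
      Finset.sum_apply, Finsupp.smul_apply, smul_eq_mul, map_mul, hv, hw, hb,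
      MvPolynomial.aeval_C, Finset.mul_sum]
    rw [Finset.sum_comm]
    exact Finset.sum_congr rfl fun i _ ↦ Finset.sum_congr rfl fun j _ ↦ by ring

/-- Generating the Lie algebra together with a fixed `f` is a nonempty Zariski open condition, so
it has solutions over an infinite ground field as soon as it has solutions over an extension. -/
lemma exists_lieSpan_pair_eq_top_of_extension [Infinite K] {E L' : Type*} [Field E] [Algebra K E]
    [LieRing L'] [LieAlgebra E L'] (b : Module.Basis ι K L) (b' : Module.Basis ι E L')
    (hb : ∀ i j k, b'.repr ⁅b' i, b' j⁆ k = algebraMap K E (b.repr ⁅b i, b j⁆ k))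
    (f : L) (x' f' : L') (hf : ∀ k, b'.repr f' k = algebraMap K E (b.repr f k))
    (htop : LieSubalgebra.lieSpan E L' {x', f'} = ⊤) :
    ∃ x : L, LieSubalgebra.lieSpan K L {x, f} = ⊤ := by
  classical
  have hspan := toSubmodule_lieSpan_pair_eq_span_evalWord (E := E) x' f'
  rw [htop, LieSubalgebra.top_toSubmodule] at hspan
  have : FiniteDimensional E L' := b'.finiteDimensional_of_finite
  obtain ⟨v, hv, hvspan, hvind⟩ :=
    Submodule.exists_fun_fin_finrank_span_eq E (Set.range (evalWord x' f'))
  have hcard : Fintype.card ι =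
      finrank E (Submodule.span E (Set.range (evalWord x' f'))) := by
    rw [← hspan, finrank_top, finrank_eq_card_basis b']
  let e : ι ≃ Fin _ := Fintype.equivFinOfCardEq hcard
  choose w hw using fun i ↦ hv (e i)
  have hdet : IsUnit (b'.det (fun i ↦ evalWord x' f' (w i))) := by
    rw [← Module.Basis.is_basis_iff_det]
    have : (fun i ↦ evalWord x' f' (w i)) = v ∘ e := funext hw
    rw [this]
    refine ⟨hvind.comp _ e.injective, ?_⟩
    rw [e.surjective.range_comp, hvspan, hspan]
  -- The chosen words form a basis at a point where this polynomial does not vanish.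
  let D : MvPolynomial ι K := Matrix.det (Matrix.of fun i j ↦ wordPoly b f (w j) i)
  have hD0 : D ≠ 0 := by
    intro h0
    apply hdet.ne_zero
    have : b'.det (fun i ↦ evalWord x' f' (w i)) =
        MvPolynomial.aeval (fun i ↦ b'.repr x' i) D := by
      rw [Module.Basis.det_apply, AlgHom.map_det]
      congr 1
      ext i j
      exact repr_evalWord b b' hb f x' f' hf (w j) i
    rw [this, h0, map_zero]
  obtain ⟨t, ht⟩ : ∃ t : ι → K, MvPolynomial.eval t D ≠ 0 := by
    by_contra! h
    exact hD0 (MvPolynomial.funext fun t ↦ by rw [h t, map_zero])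
  refine ⟨∑ i, t i • b i, ?_⟩
  have hrepr : (fun i ↦ b.repr (∑ i, t i • b i) i) = t := funext fun i ↦ by
    rw [b.repr_sum_self]
  have hunit : IsUnit (b.det (fun i ↦ evalWord (∑ i, t i • b i) f (w i))) := by
    have : b.det (fun i ↦ evalWord (∑ i, t i • b i) f (w i)) = MvPolynomial.aeval t D := by
      rw [Module.Basis.det_apply, AlgHom.map_det]
      congr 1
      ext i j
      have := repr_evalWord b b (fun _ _ _ ↦ rfl) f (∑ i, t i • b i) f (fun _ ↦ rfl) (w j) i
      rw [hrepr] at this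
      exact this
    rw [this, MvPolynomial.aeval_eq_eval]
    exact isUnit_iff_ne_zero.mpr ht
  rw [← Module.Basis.is_basis_iff_det] at hunit
  rw [← LieSubalgebra.toSubmodule_inj, LieSubalgebra.top_toSubmodule,
    toSubmodule_lieSpan_pair_eq_span_evalWord, eq_top_iff, ← hunit.2]
  refine Submodule.span_mono ?_
  rintro _ ⟨i, rfl⟩
  exact ⟨w i, rfl⟩

end Words

/-! ### Extension of scalars and descent of generating pairs -/

section BaseChange

variable (K E L : Type*) [Field K] [Field E] [Algebra K E] [LieRing L] [LieAlgebra K L]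

/-- Nondegeneracy of the Killing form is preserved by extension of scalars. -/
lemma isKilling_baseChange [FiniteDimensional K L] [IsKilling K L] : IsKilling E (E ⊗[K] L) := by
  classical
  constructor
  let b := finBasis K L
  have hnd := IsKilling.killingForm_nondegenerate K L
  rw [LinearMap.BilinForm.nondegenerate_iff_det_ne_zero b] at hnd
  have hnd' : (killingForm E (E ⊗[K] L)).Nondegenerate := by
    rw [LinearMap.BilinForm.nondegenerate_iff_det_ne_zero (b.baseChange E)]
    have : LinearMap.BilinForm.toMatrix (b.baseChange E) (killingForm E (E ⊗[K] L)) =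
        (LinearMap.BilinForm.toMatrix b (killingForm K L)).map (algebraMap K E) := by
      ext i j
      rw [killingForm, traceForm_baseChange]
      simp [LinearMap.BilinForm.toMatrix_apply, Algebra.algebraMap_eq_smul_one]
    rw [this, ← RingHom.mapMatrix_apply, ← RingHom.map_det]
    exact fun h ↦ hnd ((map_eq_zero _).mp h)
  rw [LieSubmodule.eq_bot_iff]
  intro x hx
  exact hnd'.2 x fun y ↦ (LieIdeal.mem_killingCompl E (E ⊗[K] L) ⊤).mp hx y (LieSubmodule.mem_top y)

/-- An element generating `L` as an ideal also generates every extension of scalars as an ideal. -/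
lemma lieSpan_tmul_eq_top {f : L} (hf : LieSubmodule.lieSpan K L {f} = ⊤) :
    LieSubmodule.lieSpan E (E ⊗[K] L) {(1 : E) ⊗ₜ[K] f} = ⊤ := by
  set I := LieSubmodule.lieSpan E (E ⊗[K] L) {(1 : E) ⊗ₜ[K] f}
  let J : LieIdeal K L :=
    { (I.toSubmodule.restrictScalars K).comap (TensorProduct.mk K E L 1) with
      lie_mem := fun {x m} hm ↦ by
        change (1 : E) ⊗ₜ[K] ⁅x, m⁆ ∈ I
        have : ⁅(1 : E) ⊗ₜ[K] x, (1 : E) ⊗ₜ[K] m⁆ ∈ I := I.lie_mem hm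
        simpa using this }
  have hJ : J = ⊤ := by
    rw [eq_top_iff, ← hf, LieSubmodule.lieSpan_le, Set.singleton_subset_iff]
    exact LieSubmodule.subset_lieSpan rfl
  rw [eq_top_iff]
  intro y _
  induction y using TensorProduct.induction_on with
  | zero => exact I.zero_mem
  | tmul c x =>
    have hx : x ∈ J := hJ ▸ LieSubmodule.mem_top x
    have hx : (1 : E) ⊗ₜ[K] x ∈ I := hx
    simpa [TensorProduct.smul_tmul'] using I.smul_mem c hx
  | add y z hy hz => exact I.add_mem (hy trivial) (hz trivial)

end BaseChange

section Descent

variable {K L : Type*} [Field K] [CharZero K] [LieRing L] [LieAlgebra K L] [FiniteDimensional K L]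

/-- In a semisimple Lie algebra over a field of characteristic zero, an element which generates
the whole algebra as an ideal belongs to a generating pair. -/
lemma exists_lieSpan_pair_eq_top_of_isKilling [IsKilling K L] {f : L}
    (hf : LieSubmodule.lieSpan K L {f} = ⊤) :
    ∃ x : L, LieSubalgebra.lieSpan K L {x, f} = ⊤ := by
  let E := AlgebraicClosure K
  have : CharZero E := charZero_of_injective_algebraMap (algebraMap K E).injective
  have := isKilling_baseChange K E L
  obtain ⟨x', hx'⟩ := exists_lieSpan_pair_eq_top (lieSpan_tmul_eq_top K E L hf)
  let b := finBasis K L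
  refine exists_lieSpan_pair_eq_top_of_extension b (b.baseChange E) (fun i j k ↦ ?_) f x' _
    (fun k ↦ ?_) hx'
  · simp [Algebra.algebraMap_eq_smul_one]
  · simp [Algebra.algebraMap_eq_smul_one]

end Descent

end LieAlgebra

namespace LieAlgebra

open Module LieModule

/-! ### Maximal subalgebras of simple Lie algebras -/

section Simple

variable {K L : Type*} [Field K] [LieRing L] [LieAlgebra K L] [FiniteDimensional K L]

/-- Elements lying in every maximal subalgebra can be dropped from generating sets. -/
lemma lieSpan_singleton_eq_top_of_pair {x f : L}
    (hf : ∀ N : LieSubalgebra K L, IsCoatom N → f ∈ N)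
    (hx : LieSubalgebra.lieSpan K L {x, f} = ⊤) : LieSubalgebra.lieSpan K L {x} = ⊤ := by
  by_contra hne
  obtain ⟨N, hN, hle⟩ :=
    (eq_top_or_exists_le_coatom (LieSubalgebra.lieSpan K L {x})).resolve_left hne
  refine hN.1 (top_le_iff.mp (hx ▸ ?_))
  rw [LieSubalgebra.lieSpan_le]
  rintro y (rfl | rfl)
  · exact hle (LieSubalgebra.subset_lieSpan rfl)
  · exact hf N hN

omit [FiniteDimensional K L] in
lemma isLieAbelian_of_lieSpan_singleton_eq_top {x : L}
    (hx : LieSubalgebra.lieSpan K L {x} = ⊤) : IsLieAbelian L := by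
  have h1 (y : L) : ⁅y, x⁆ = 0 := by
    have hy : y ∈ LieSubalgebra.lieSpan K L {x} := hx ▸ LieSubalgebra.mem_top y
    induction hy using LieSubalgebra.lieSpan_induction with
    | mem u hu => rw [Set.mem_singleton_iff.mp hu, lie_self]
    | zero => simp
    | add u v _ _ hu hv => rw [add_lie, hu, hv, add_zero]
    | smul t u _ hu => rw [smul_lie, hu, smul_zero]
    | lie u v _ _ hu hv => rw [lie_lie, hu, hv, lie_zero, lie_zero, sub_zero]
  refine ⟨fun z y ↦ ?_⟩
  have hy : y ∈ LieSubalgebra.lieSpan K L {x} := hx ▸ LieSubalgebra.mem_top y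
  induction hy using LieSubalgebra.lieSpan_induction generalizing z with
  | mem u hu => rw [Set.mem_singleton_iff.mp hu, h1]
  | zero => simp
  | add u v _ _ hu hv => rw [lie_add, hu, hv, add_zero]
  | smul t u _ hu => rw [lie_smul, hu, smul_zero]
  | lie u v _ _ hu hv => rw [leibniz_lie, hv, hv, lie_zero, add_zero]

/-- In a simple Lie algebra of characteristic zero, any nonzero element belongs to a generating
pair, hence is missed by some maximal subalgebra. -/
lemma eq_zero_of_forall_mem_coatom_of_isSimple [CharZero K] [IsSimple K L] {f : L}
    (hf : ∀ N : LieSubalgebra K L, IsCoatom N → f ∈ N) : f = 0 := by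
  by_contra hf0
  have hspan : LieSubmodule.lieSpan K L {f} = ⊤ :=
    (IsSimple.eq_bot_or_eq_top (R := K) (LieSubmodule.lieSpan K L {f})).resolve_left fun h ↦
      hf0 (by
        have : f ∈ LieSubmodule.lieSpan K L {f} := LieSubmodule.subset_lieSpan rfl
        rw [h] at this
        simpa using this)
  obtain ⟨x, hx⟩ := exists_lieSpan_pair_eq_top_of_isKilling hspan
  exact IsSimple.non_abelian (R := K) (L := L)
    (isLieAbelian_of_lieSpan_singleton_eq_top (lieSpan_singleton_eq_top_of_pair hf hx))

end Simple

/-! ### Maximal subalgebras of semisimple Lie algebras -/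

section Semisimple

variable {K L L' : Type*} [Field K] [LieRing L] [LieAlgebra K L] [LieRing L'] [LieAlgebra K L']

/-- The preimage of a maximal subalgebra under a surjective homomorphism is maximal, so the
intersection of the maximal subalgebras is mapped into its counterpart. -/
lemma forall_mem_coatom_map {φ : L →ₗ⁅K⁆ L'} (hφ : Function.Surjective φ) {f : L}
    (hf : ∀ N : LieSubalgebra K L, IsCoatom N → f ∈ N) :
    ∀ N : LieSubalgebra K L', IsCoatom N → φ f ∈ N := by
  intro N hN
  refine hf (N.comap φ) ⟨fun h ↦ hN.1 ?_, fun S hS ↦ ?_⟩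
  · rw [eq_top_iff]
    intro y _
    obtain ⟨x, rfl⟩ := hφ y
    have : x ∈ N.comap φ := h ▸ LieSubalgebra.mem_top x
    exact this
  · have hle : N ≤ S.map φ := by
      intro y hy
      obtain ⟨x, rfl⟩ := hφ y
      exact ⟨x, hS.le hy, rfl⟩
    have hker : ∀ z ∈ S.map φ, ∀ x, φ x = z → x ∈ S := by
      rintro z ⟨s, hs, rfl⟩ x hx
      have h1 : x - s ∈ N.comap φ := by
        change φ (x - s) ∈ N
        have : φ (s : L) = φ x := hx.symm
        rw [map_sub, ← this, sub_self]
        exact N.zero_mem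
      simpa using S.add_mem (hS.le h1) hs
    have hlt : N < S.map φ := by
      refine lt_of_le_of_ne hle fun h ↦ hS.not_ge fun s hs ↦ ?_
      change φ s ∈ N
      rw [h]
      exact ⟨s, hs, rfl⟩
    rw [eq_top_iff]
    intro x _
    exact hker (φ x) (hN.2 _ hlt ▸ LieSubalgebra.mem_top _) x rfl

/-- The quotient map of a Lie algebra by an ideal, as a homomorphism of Lie algebras. -/
def quotientMk (J : LieIdeal K L) : L →ₗ⁅K⁆ L ⧸ J :=
  { (LieSubmodule.Quotient.mk' J : L →ₗ[K] L ⧸ J) with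
    map_lie' := fun {x y} ↦ LieSubmodule.Quotient.mk_bracket J x y }

lemma surjective_quotientMk (J : LieIdeal K L) : Function.Surjective (quotientMk J) :=
  LieSubmodule.Quotient.surjective_mk' J

lemma quotientMk_eq_zero {J : LieIdeal K L} {x : L} : quotientMk J x = 0 ↔ x ∈ J :=
  LieSubmodule.Quotient.mk_eq_zero J

/-- If a minimal nonabelian ideal has a complementary ideal, then the quotient by the latter is
simple. -/
lemma isSimple_quotient_of_isCompl {I J : LieIdeal K L} (hI : IsAtom I) (hI' : ¬ IsLieAbelian I)
    (hIJ : IsCompl I J) : IsSimple K (L ⧸ J) := by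
  refine ⟨fun X ↦ ?_, fun hab ↦ hI' ⟨fun x y ↦ ?_⟩⟩
  · have hJX : J ≤ X.comap (quotientMk J) := fun y hy ↦ by
      rw [LieIdeal.mem_comap, quotientMk_eq_zero.mpr hy]
      exact X.zero_mem
    rcases hI.le_iff.mp (inf_le_left : I ⊓ X.comap (quotientMk J) ≤ I) with h | h
    · left
      have h2 : X.comap (quotientMk J) ≤ J := by
        have := inf_sup_assoc_of_le I hJX
        rw [inf_comm, h, bot_sup_eq, hIJ.sup_eq_top, inf_top_eq] at this
        exact this.ge
      rw [LieSubmodule.eq_bot_iff]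
      intro y hy
      obtain ⟨x, rfl⟩ := surjective_quotientMk J y
      exact quotientMk_eq_zero.mpr (h2 hy)
    · right
      have h2 : X.comap (quotientMk J) = ⊤ := by
        rw [eq_top_iff, ← hIJ.sup_eq_top]
        exact sup_le (inf_eq_left.mp h) hJX
      rw [eq_top_iff]
      intro y _
      obtain ⟨x, rfl⟩ := surjective_quotientMk J y
      have : x ∈ X.comap (quotientMk J) := h2 ▸ LieSubmodule.mem_top x
      exact this
  · have h1 : ⁅(x : L), (y : L)⁆ ∈ I ⊓ J := by
      refine ⟨lie_mem_right K L I _ _ y.2, quotientMk_eq_zero.mp ?_⟩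
      rw [LieHom.map_lie]
      exact hab.trivial _ _
    rw [hIJ.inf_eq_bot] at h1
    exact Subtype.ext (by simpa using h1)

variable [FiniteDimensional K L] [CharZero K]

/-- In a semisimple Lie algebra of characteristic zero the maximal subalgebras intersect trivially:
by the simple case, the ideal generated by an element of the intersection is orthogonal to all
minimal ideals for the Killing form. -/
lemma eq_zero_of_forall_mem_coatom_of_isKilling [IsKilling K L] {f : L}
    (hf : ∀ N : LieSubalgebra K L, IsCoatom N → f ∈ N) : f = 0 := by
  have hperp : ∀ I : LieIdeal K L, IsAtom I → I ≤ LieIdeal.killingCompl K L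
      (LieSubmodule.lieSpan K L {f}) := by
    intro I hI
    have hcompl := LieIdeal.isCompl_killingCompl I
    have := isSimple_quotient_of_isCompl hI (IsSemisimple.non_abelian_of_isAtom I hI) hcompl
    have h0 := eq_zero_of_forall_mem_coatom_of_isSimple
      (forall_mem_coatom_map (surjective_quotientMk (LieIdeal.killingCompl K L I)) hf)
    rw [quotientMk_eq_zero] at h0
    have h1 : LieSubmodule.lieSpan K L {f} ≤ LieIdeal.killingCompl K L I := by
      rw [LieSubmodule.lieSpan_le, Set.singleton_subset_iff]
      exact h0
    intro x hx
    rw [LieIdeal.mem_killingCompl]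
    intro y hy
    rw [traceForm_comm]
    exact (LieIdeal.mem_killingCompl K L I).mp (h1 hy) x hx
  have htop : (⊤ : LieIdeal K L) ≤ LieIdeal.killingCompl K L (LieSubmodule.lieSpan K L {f}) := by
    rw [← IsSemisimple.sSup_atoms_eq_top (R := K) (L := L)]
    exact sSup_le hperp
  have hmem : f ∈ LieIdeal.killingCompl K L ⊤ := by
    rw [LieIdeal.mem_killingCompl]
    intro y hy
    rw [traceForm_comm]
    exact (LieIdeal.mem_killingCompl K L _).mp (htop hy) f (LieSubmodule.subset_lieSpan rfl)
  rw [IsKilling.killingCompl_top_eq_bot] at hmem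
  simpa using hmem

end Semisimple

/-! ### Maximal subalgebras in the presence of a faithful irreducible representation -/

section Reductive

open Polynomial in
/-- In characteristic zero an endomorphism `a` is nilpotent as soon as all polynomial multiples of
`a` have trace zero: one of these multiples is the projection onto the part where `a` is
invertible. -/
lemma isNilpotent_of_trace_aeval_mul_eq_zero {K V : Type*} [Field K] [CharZero K] [AddCommGroup V]
    [Module K V] [FiniteDimensional K V] (a : End K V)
    (h : ∀ q : Polynomial K, LinearMap.trace K V (a * Polynomial.aeval a q) = 0) :
    _root_.IsNilpotent a := by
  have hm : minpoly K a ≠ 0 := minpoly.ne_zero (Algebra.IsIntegral.isIntegral a)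
  obtain ⟨r, hr, hrX⟩ := exists_eq_pow_rootMultiplicity_mul_and_not_dvd (minpoly K a) hm 0
  set k := rootMultiplicity 0 (minpoly K a)
  rw [C_0, sub_zero] at hr hrX
  obtain ⟨u, v, huv⟩ : IsCoprime (X ^ (k + 1) : K[X]) r :=
    (((irreducible_X (R := K)).coprime_iff_not_dvd).mpr hrX).pow_left
  have hkr : aeval a (X ^ k : K[X]) * aeval a r = 0 := by
    rw [← map_mul, ← hr, minpoly.aeval]
  set e := aeval a (u * X ^ (k + 1))
  have he' : e + aeval a (v * r) = 1 := by rw [← map_add, huv, map_one]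
  have hmul : e * aeval a (v * r) = 0 := by
    rw [← map_mul, show u * X ^ (k + 1) * (v * r) = (u * v * X) * (X ^ k * r) by ring, map_mul,
      map_mul (aeval a) (X ^ k : K[X]), hkr, mul_zero]
  have hidem : IsIdempotentElem e := by
    have := congrArg (e * ·) he'
    rwa [mul_add, hmul, add_zero, mul_one] at this
  have he0 : e = 0 := by
    refine LinearMap.IsIdempotentElem.eq_zero_of_trace_eq_zero hidem ?_
    have hea : e = a * aeval a (u * X ^ k) := by
      change aeval a (u * X ^ (k + 1)) = _
      rw [show u * X ^ (k + 1) = X * (u * X ^ k) by ring, map_mul, aeval_X]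
    rw [hea, h]
  refine ⟨k, ?_⟩
  rw [he0, zero_add] at he'
  have := congrArg (aeval a (X ^ k : K[X]) * ·) he'
  simp only [mul_one] at this
  rw [mul_comm v r, map_mul, ← mul_assoc, hkr, zero_mul] at this
  simpa using this.symm

variable {K L : Type*} (M : Type*) [Field K] [LieRing L] [LieAlgebra K L]
  [AddCommGroup M] [Module K M] [LieRingModule L M] [LieModule K L M]

variable {M} in
/-- The trace of a commutator against an endomorphism commuting with one of its entries. -/
lemma trace_toEnd_lie_mul_of_commute (x y : L) (w : End K M) (hw : Commute w (toEnd K L M y)) :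
    LinearMap.trace K M (toEnd K L M ⁅x, y⁆ * w) = 0 := by
  have h1 : toEnd K L M ⁅x, y⁆ = toEnd K L M x * toEnd K L M y - toEnd K L M y * toEnd K L M x := by
    ext m
    simp
  rw [h1, sub_mul, map_sub, mul_assoc, ← hw.eq, ← mul_assoc, sub_eq_zero,
    LinearMap.trace_mul_comm, mul_assoc]

variable [CharZero K] [FiniteDimensional K M] [IsIrreducible K L M] [IsFaithful K L M]

include M

/-- If `L` acts faithfully and irreducibly then an abelian ideal is central, as its commutators with
`L` act nilpotently. -/
lemma lie_top_eq_bot_of_isLieAbelian (J : LieIdeal K L) (hJ : ∀ x ∈ J, ∀ y ∈ J, ⁅x, y⁆ = 0) :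
    ⁅(⊤ : LieIdeal K L), J⁆ = ⊥ := by
  set N : LieIdeal K L := ⁅(⊤ : LieIdeal K L), J⁆
  have hNJ : N ≤ J := LieSubmodule.lie_le_right J ⊤
  have hcomm : ∀ x ∈ J, ∀ y ∈ J, Commute (toEnd K L M x) (toEnd K L M y) := fun x hx y hy ↦ by
    ext m
    have h1 := lie_lie x y m
    rw [hJ x hx y hy, zero_lie] at h1
    exact (sub_eq_zero.mp h1.symm)
  have htrace : ∀ a ∈ N, ∀ w : End K M, (∀ y ∈ J, Commute w (toEnd K L M y)) →
      LinearMap.trace K M (toEnd K L M a * w) = 0 := by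
    intro a ha w hw
    replace ha : a ∈ N.toSubmodule := ha
    rw [LieSubmodule.lieIdeal_oper_eq_linear_span'] at ha
    induction ha using Submodule.span_induction with
    | mem u hu =>
      obtain ⟨x, -, y, hy, rfl⟩ := hu
      exact trace_toEnd_lie_mul_of_commute x y w (hw y hy)
    | zero => simp
    | add u v _ _ hu hv => rw [map_add, add_mul, map_add, hu, hv, add_zero]
    | smul t u _ hu => rw [map_smul, smul_mul_assoc, map_smul, hu, smul_zero]
  have hnil : ∀ a ∈ N, _root_.IsNilpotent (toEnd K L M a) := fun a ha ↦
    isNilpotent_of_trace_aeval_mul_eq_zero _ fun q ↦ htrace a ha _ fun y hy ↦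
      (Algebra.commute_of_mem_adjoin_singleton_of_commute
        (Polynomial.aeval_mem_adjoin_singleton K (toEnd K L M a) (p := q))
        (hcomm a (hNJ ha) y hy).symm).symm
  -- By Engel's theorem the vectors annihilated by `N` form a nonzero submodule.
  have : Nontrivial M := nontrivial_of_isIrreducible K L M
  have : LieModule.IsNilpotent N M :=
    isNilpotent_iff_forall' (R := K) |>.mpr fun a ↦ hnil a a.2
  have hne := nontrivial_max_triv_of_isNilpotent K N M
  let P : LieSubmodule K L M :=
    { (maxTrivSubmodule K N M).toSubmodule with
      lie_mem := fun {x m} hm ↦ by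
        have hm : m ∈ maxTrivSubmodule K N M := hm
        change ⁅x, m⁆ ∈ maxTrivSubmodule K N M
        rw [mem_maxTrivSubmodule] at hm ⊢
        intro a
        change ⁅(a : L), ⁅x, m⁆⁆ = 0
        rw [leibniz_lie]
        have h1 : ⁅⁅(a : L), x⁆, m⁆ = 0 := hm ⟨⁅(a : L), x⁆, lie_mem_left K L N _ _ a.2⟩
        have h2 : ⁅(a : L), m⁆ = 0 := hm a
        rw [h1, h2, lie_zero, add_zero] }
  have hP : P = ⊤ := by
    have : Nontrivial P := hne
    exact P.eq_top_of_isIrreducible K L M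
  rw [LieSubmodule.eq_bot_iff]
  intro a ha
  rw [← toEnd_eq_zero_iff K L M]
  ext m
  have hm : m ∈ P := hP ▸ LieSubmodule.mem_top m
  exact (mem_maxTrivSubmodule K N M m).mp hm ⟨a, ha⟩

/-- If `L` acts faithfully and irreducibly then an abelian ideal meets the derived algebra
trivially: a nonzero element of the intersection would be central, hence invertible by Schur's
lemma, whereas its product with its inverse would have trace zero. -/
lemma inf_lie_top_top_eq_bot_of_isLieAbelian (J : LieIdeal K L)
    (hJ : ∀ x ∈ J, ∀ y ∈ J, ⁅x, y⁆ = 0) : J ⊓ ⁅(⊤ : LieIdeal K L), (⊤ : LieIdeal K L)⁆ = ⊥ := by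
  have hcent := lie_top_eq_bot_of_isLieAbelian M J hJ
  rw [LieSubmodule.eq_bot_iff]
  rintro z ⟨hzJ, hz⟩
  by_contra hz0
  have hzc (x : L) : ⁅x, z⁆ = 0 := by
    have : ⁅x, z⁆ ∈ ⁅(⊤ : LieIdeal K L), J⁆ := LieSubmodule.lie_mem_lie (LieSubmodule.mem_top x) hzJ
    rw [hcent] at this
    simpa using this
  have hcomm (x : L) : toEnd K L M x * toEnd K L M z = toEnd K L M z * toEnd K L M x := by
    ext m
    have h1 := lie_lie x z m
    rw [hzc, zero_lie] at h1
    exact (sub_eq_zero.mp h1.symm)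
  let P : LieSubmodule K L M :=
    { LinearMap.ker (toEnd K L M z) with
      lie_mem := fun {x m} hm ↦ by
        have hm : toEnd K L M z m = 0 := hm
        change (toEnd K L M z * toEnd K L M x) m = 0
        rw [← hcomm, Module.End.mul_apply, hm, map_zero] }
  have hP : P = ⊥ := by
    refine (eq_bot_or_eq_top P).resolve_right fun h ↦ hz0 ?_
    rw [← toEnd_eq_zero_iff K L M]
    ext m
    have hm : m ∈ P := h ▸ LieSubmodule.mem_top m
    exact hm
  have hker : LinearMap.ker (toEnd K L M z) = ⊥ := congrArg LieSubmodule.toSubmodule hP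
  have hunit : IsUnit (toEnd K L M z) := (LinearMap.isUnit_iff_ker_eq_bot _).mpr hker
  obtain ⟨w, hw⟩ := hunit
  have hwc (x : L) : Commute (↑w⁻¹ : End K M) (toEnd K L M x) := by
    apply Commute.units_inv_left
    rw [hw]
    exact (hcomm x).symm
  have htr : LinearMap.trace K M (toEnd K L M z * ↑w⁻¹) = 0 := by
    replace hz : z ∈ (⁅(⊤ : LieIdeal K L), (⊤ : LieIdeal K L)⁆).toSubmodule := hz
    rw [LieSubmodule.lieIdeal_oper_eq_linear_span'] at hz
    clear hzJ hz0 hzc hcomm P hP hker hw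
    induction hz using Submodule.span_induction with
    | mem u hu =>
      obtain ⟨x, -, y, -, rfl⟩ := hu
      exact trace_toEnd_lie_mul_of_commute x y _ (hwc y)
    | zero => simp
    | add u v _ _ hu hv => rw [map_add, add_mul, map_add, hu, hv, add_zero]
    | smul t u _ hu => rw [map_smul, smul_mul_assoc, map_smul, hu, smul_zero]
  rw [← hw, Units.mul_inv, LinearMap.trace_one] at htr
  have : Nontrivial M := nontrivial_of_isIrreducible K L M
  exact finrank_pos.ne' (Nat.cast_eq_zero.mp htr)

variable [FiniteDimensional K L]

/-- If `L` acts faithfully and irreducibly then its radical meets the derived algebra trivially,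
since the last nonzero term of the derived series of the radical is an abelian ideal. -/
lemma radical_inf_lie_top_top_eq_bot :
    radical K L ⊓ ⁅(⊤ : LieIdeal K L), (⊤ : LieIdeal K L)⁆ = ⊥ := by
  have hstep : ∀ k, derivedSeriesOfIdeal K L (k + 2) (radical K L) = ⊥ →
      derivedSeriesOfIdeal K L (k + 1) (radical K L) = ⊥ := by
    intro k hk
    rw [derivedSeriesOfIdeal_succ] at hk
    have hab := inf_lie_top_top_eq_bot_of_isLieAbelian M
      (derivedSeriesOfIdeal K L (k + 1) (radical K L)) fun x hx y hy ↦ by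
        have := LieSubmodule.lie_mem_lie hx hy
        rw [hk] at this
        simpa using this
    rwa [inf_eq_left.mpr] at hab
    rw [derivedSeriesOfIdeal_succ]
    exact LieSubmodule.mono_lie le_top le_top
  have hone : derivedSeriesOfIdeal K L 1 (radical K L) = ⊥ := by
    obtain ⟨k, hk⟩ := IsSolvable.solvable K (radical K L)
    rw [LieIdeal.derivedSeries_eq_bot_iff] at hk
    have hk' : derivedSeriesOfIdeal K L (k + 1) (radical K L) = ⊥ :=
      le_bot_iff.mp (hk ▸ derivedSeriesOfIdeal_succ_le _ k)
    clear hk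
    induction k with
    | zero => exact hk'
    | succ k ih => exact ih (hstep k hk')
  refine inf_lie_top_top_eq_bot_of_isLieAbelian M _ fun x hx y hy ↦ ?_
  have := LieSubmodule.lie_mem_lie hx hy
  rw [derivedSeriesOfIdeal_succ, derivedSeriesOfIdeal_zero] at hone
  rw [hone] at this
  simpa using this

omit M [AddCommGroup M] [Module K M] [LieRingModule L M] [LieModule K L M] [CharZero K]
  [FiniteDimensional K M] [IsIrreducible K L M] [IsFaithful K L M] in
lemma hasTrivialRadical_quotient_radical : HasTrivialRadical K (L ⧸ radical K L) := by
  rw [hasTrivialRadical_iff_no_abelian_ideals]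
  intro I hI
  set J := I.comap (quotientMk (radical K L))
  have hJ : derivedSeriesOfIdeal K L 1 J ≤ radical K L := by
    rw [derivedSeriesOfIdeal_succ, derivedSeriesOfIdeal_zero, LieSubmodule.lie_le_iff]
    intro x hx y hy
    rw [← quotientMk_eq_zero, LieHom.map_lie]
    exact congrArg Subtype.val (hI.trivial ⟨_, hx⟩ ⟨_, hy⟩)
  obtain ⟨k, hk⟩ := IsSolvable.solvable K (radical K L)
  rw [LieIdeal.derivedSeries_eq_bot_iff] at hk
  have hJs : IsSolvable J := by
    refine IsSolvable.mk (R := K) (k := k + 1) ?_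
    rw [LieIdeal.derivedSeries_eq_bot_iff, derivedSeriesOfIdeal_add, eq_bot_iff, ← hk]
    exact derivedSeriesOfIdeal_mono hJ k
  have hle : J ≤ radical K L := (LieIdeal.solvable_iff_le_radical K L J).mp hJs
  rw [LieSubmodule.eq_bot_iff]
  intro y hy
  obtain ⟨x, rfl⟩ := surjective_quotientMk (radical K L) y
  exact quotientMk_eq_zero.mpr (hle hy)

/-- If a Lie algebra of characteristic zero has a faithful irreducible representation, then its
maximal subalgebras intersect trivially. -/
lemma eq_zero_of_forall_mem_coatom_of_isIrreducible {f : L}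
    (hf : ∀ N : LieSubalgebra K L, IsCoatom N → f ∈ N) : f = 0 := by
  have := hasTrivialRadical_quotient_radical (K := K) (L := L)
  have hrad : f ∈ radical K L := quotientMk_eq_zero.mp <|
    eq_zero_of_forall_mem_coatom_of_isKilling
      (forall_mem_coatom_map (surjective_quotientMk (radical K L)) hf)
  by_contra hf0
  have hnot : f ∉ (⁅(⊤ : LieIdeal K L), (⊤ : LieIdeal K L)⁆).toSubmodule := by
    intro h
    have h1 : f ∈ radical K L ⊓ ⁅(⊤ : LieIdeal K L), (⊤ : LieIdeal K L)⁆ := ⟨hrad, h⟩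
    rw [radical_inf_lie_top_top_eq_bot M] at h1
    exact hf0 (by simpa using h1)
  -- A hyperplane containing the derived algebra is a maximal subalgebra.
  obtain ⟨φ, hφf, hφ⟩ := Submodule.exists_le_ker_of_notMem hnot
  let N : LieSubalgebra K L :=
    { LinearMap.ker φ with
      lie_mem' := fun {x y} _ _ ↦ hφ (LieSubmodule.lie_mem_lie (LieSubmodule.mem_top x)
        (LieSubmodule.mem_top y)) }
  have hφ0 : φ ≠ 0 := fun h ↦ hφf (by rw [h, LinearMap.zero_apply])
  have hker : IsCoatom (LinearMap.ker φ) :=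
    LinearMap.isCoatom_ker_of_surjective (LinearMap.surjective hφ0)
  have hN : IsCoatom N := by
    refine ⟨fun h ↦ hker.1 (congrArg LieSubalgebra.toSubmodule h), fun S hS ↦ ?_⟩
    have : LinearMap.ker φ < S.toSubmodule := hS
    rw [← LieSubalgebra.toSubmodule_inj, hker.2 _ this, LieSubalgebra.top_toSubmodule]
  exact hφf (hf N hN)

end Reductive

end LieAlgebra

namespace Leibniz

/-! ### Ideals, cores and the Frattini subalgebra -/

section Basic

variable {K A : Type*} [Field K] [NonUnitalNonAssocRing A] [Module K A]

lemma isIdeal_inf {I J : Submodule K A} (hI : IsIdeal I) (hJ : IsIdeal J) : IsIdeal (I ⊓ J) :=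
  fun a x hx ↦ ⟨⟨(hI a x hx.1).1, (hJ a x hx.2).1⟩, ⟨(hI a x hx.1).2, (hJ a x hx.2).2⟩⟩

/-- The core of a subalgebra: the largest ideal contained in it, as the sum of all such ideals. -/
def core (M : NonUnitalSubalgebra K A) : Submodule K A :=
  sSup {I : Submodule K A | IsIdeal I ∧ I ≤ M.toSubmodule}

lemma core_le (M : NonUnitalSubalgebra K A) : core M ≤ M.toSubmodule :=
  sSup_le fun _ hI ↦ hI.2

lemma le_core {M : NonUnitalSubalgebra K A} {I : Submodule K A} (hI : IsIdeal I)
    (hIM : I ≤ M.toSubmodule) : I ≤ core M :=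
  le_sSup ⟨hI, hIM⟩

variable [IsScalarTower K A A] [SMulCommClass K A A]

lemma isIdeal_sSup {s : Set (Submodule K A)} (hs : ∀ I ∈ s, IsIdeal I) : IsIdeal (sSup s) := by
  intro a x hx
  have hl : sSup s ≤ (sSup s).comap (LinearMap.mulLeft K a) :=
    sSup_le fun I hI y hy ↦ (le_sSup hI : I ≤ sSup s) (hs I hI a y hy).1
  have hr : sSup s ≤ (sSup s).comap (LinearMap.mulRight K a) :=
    sSup_le fun I hI y hy ↦ (le_sSup hI : I ≤ sSup s) (hs I hI a y hy).2
  exact ⟨hl hx, hr hx⟩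

lemma isIdeal_core (M : NonUnitalSubalgebra K A) : IsIdeal (core M) :=
  isIdeal_sSup fun _ hI ↦ hI.1

lemma mem_frattiniSubalgebra {x : A} :
    x ∈ frattiniSubalgebra K A ↔ ∀ M : NonUnitalSubalgebra K A, IsCoatom M → x ∈ M := by
  rw [frattiniSubalgebra, NonUnitalAlgebra.mem_sInf]
  rfl

variable {B : Type*} [NonUnitalNonAssocRing B] [Module K B] [IsScalarTower K B B]
  [SMulCommClass K B B]

lemma isCoatom_comap {φ : A →ₙₐ[K] B} (hφ : Function.Surjective φ) {N : NonUnitalSubalgebra K B}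
    (hN : IsCoatom N) : IsCoatom (N.comap φ) := by
  refine ⟨fun h ↦ hN.1 ?_, fun S hS ↦ ?_⟩
  · rw [eq_top_iff]
    intro y _
    obtain ⟨x, rfl⟩ := hφ y
    have : x ∈ N.comap φ := h ▸ NonUnitalAlgebra.mem_top
    exact this
  · have hle : N ≤ S.map φ := by
      intro y hy
      obtain ⟨x, rfl⟩ := hφ y
      exact ⟨x, hS.le hy, rfl⟩
    have hker : ∀ z ∈ S.map φ, ∀ x, φ x = z → x ∈ S := by
      rintro z ⟨s, hs, rfl⟩ x hx
      have h1 : x - s ∈ N.comap φ := by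
        change φ (x - s) ∈ N
        have : φ s = φ x := hx.symm
        rw [map_sub, ← this, sub_self]
        exact N.zero_mem
      simpa using S.add_mem (hS.le h1) hs
    have hlt : N < S.map φ := by
      refine lt_of_le_of_ne hle fun h ↦ hS.not_ge fun s hs ↦ ?_
      change φ s ∈ N
      rw [h]
      exact ⟨s, hs, rfl⟩
    rw [eq_top_iff]
    intro x _
    exact hker (φ x) (hN.2 _ hlt ▸ NonUnitalAlgebra.mem_top) x rfl

/-- Surjective homomorphisms map the Frattini subalgebra into the Frattini subalgebra. -/
lemma map_mem_frattiniSubalgebra {φ : A →ₙₐ[K] B}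
    (hφ : Function.Surjective φ) {x : A} (hx : x ∈ frattiniSubalgebra K A) :
    φ x ∈ frattiniSubalgebra K B := by
  rw [mem_frattiniSubalgebra] at hx ⊢
  exact fun N hN ↦ hx (N.comap φ) (isCoatom_comap hφ hN)

end Basic

/-! ### Quotients by ideals -/

section Quotient

universe u v

variable {K : Type u} {A : Type v} [Field K] [NonUnitalNonAssocRing A] [Module K A]
  [IsScalarTower K A A] [SMulCommClass K A A]

/-- The product induced on the quotient by an ideal, as a bilinear map. -/
def mulQ (C : Submodule K A) (hC : IsIdeal C) : A ⧸ C →ₗ[K] A ⧸ C →ₗ[K] A ⧸ C :=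
  C.liftQ
    { toFun := fun a ↦ C.mapQ C (LinearMap.mulLeft K a) fun x hx ↦ (hC a x hx).1
      map_add' := fun a b ↦ by
        ext x
        exact congrArg C.mkQ (add_mul a b x)
      map_smul' := fun t a ↦ by
        ext x
        exact congrArg C.mkQ (smul_mul_assoc t a x) }
    (fun a ha ↦ by
      rw [LinearMap.mem_ker]
      ext x
      exact (Submodule.Quotient.mk_eq_zero C).mpr (hC x a ha).2)

/-- Every ideal is the kernel of a surjective homomorphism of algebras. -/
lemma exists_quotient (C : Submodule K A) (hC : IsIdeal C) :
    ∃ (B : Type v) (_ : NonUnitalNonAssocRing B) (_ : Module K B) (_ : IsScalarTower K B B)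
      (_ : SMulCommClass K B B) (φ : A →ₙₐ[K] B),
      Function.Surjective φ ∧ ∀ x, φ x = 0 ↔ x ∈ C := by
  let _ : NonUnitalNonAssocRing (A ⧸ C) :=
    { (inferInstance : AddCommGroup (A ⧸ C)) with
      mul := fun x y ↦ mulQ C hC x y
      left_distrib := fun x y z ↦ map_add (mulQ C hC x) y z
      right_distrib := fun x y z ↦ LinearMap.map_add₂ (mulQ C hC) x y z
      zero_mul := fun x ↦ LinearMap.map_zero₂ (mulQ C hC) x
      mul_zero := fun x ↦ map_zero (mulQ C hC x) }
  exact ⟨A ⧸ C, inferInstance, inferInstance,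
    ⟨fun t x y ↦ LinearMap.map_smul₂ (mulQ C hC) t x y⟩,
    ⟨fun t x y ↦ (map_smul (mulQ C hC x) t y).symm⟩,
    { C.mkQ with
      map_zero' := map_zero C.mkQ
      map_mul' := fun _ _ ↦ rfl }, C.mkQ_surjective, fun _ ↦ Submodule.Quotient.mk_eq_zero C⟩

end Quotient

/-! ### Leibniz algebras that are Lie algebras -/

section Lie

variable {K A : Type*} [Field K] [NonUnitalNonAssocRing A] [Module K A]
  [IsScalarTower K A A] [SMulCommClass K A A] [IsLeibniz A]

/-- A Leibniz algebra in which all squares vanish is a Lie ring, with its product as bracket. -/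
abbrev lieRing (h : ∀ x : A, x * x = 0) : LieRing A :=
  { (inferInstance : AddCommGroup A) with
    bracket := fun x y ↦ x * y
    add_lie := add_mul
    lie_add := mul_add
    lie_self := h
    leibniz_lie := IsLeibniz.leibniz }

/-- The algebra structure on the Lie ring `Leibniz.lieRing`. -/
abbrev lieAlgebra (h : ∀ x : A, x * x = 0) : letI := lieRing h; LieAlgebra K A :=
  let := lieRing h
  { (inferInstance : Module K A) with
    lie_smul := fun t x y ↦ mul_smul_comm t x y }

/-- Under the identification of `Leibniz.lieRing`, maximal Lie subalgebras are maximal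
subalgebras. -/
lemma mem_coatom_of_mem_frattiniSubalgebra (h : ∀ x : A, x * x = 0) {f : A}
    (hf : f ∈ frattiniSubalgebra K A) :
    letI := lieRing h
    letI := lieAlgebra (K := K) h
    ∀ N : LieSubalgebra K A, IsCoatom N → f ∈ N := by
  let := lieRing h
  let := lieAlgebra (K := K) h
  intro N hN
  let e : LieSubalgebra K A ≃o NonUnitalSubalgebra K A :=
    { toFun := fun S ↦ { S.toSubmodule with mul_mem' := fun hx hy ↦ S.lie_mem hx hy }
      invFun := fun S ↦ { S.toSubmodule with lie_mem' := fun hx hy ↦ S.mul_mem hx hy }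
      left_inv := fun _ ↦ rfl
      right_inv := fun _ ↦ rfl
      map_rel_iff' := Iff.rfl }
  exact mem_frattiniSubalgebra.mp hf (e N) ((e.isCoatom_iff N).mpr hN)

variable [CharZero K] [FiniteDimensional K A]

lemma eq_zero_of_mem_frattiniSubalgebra_of_no_abelian_ideals (h : ∀ x : A, x * x = 0)
    (hA : ∀ I : Submodule K A, IsIdeal I → (∀ x ∈ I, ∀ y ∈ I, x * y = 0) → I = ⊥)
    {f : A} (hf : f ∈ frattiniSubalgebra K A) : f = 0 := by
  let := lieRing h
  let := lieAlgebra (K := K) h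
  have : LieAlgebra.HasTrivialRadical K A := by
    rw [LieAlgebra.hasTrivialRadical_iff_no_abelian_ideals]
    intro I hI
    have hbot := hA I.toSubmodule (fun a x hx ↦ ⟨I.lie_mem hx, lie_mem_left K A I x a hx⟩)
      fun x hx y hy ↦ congrArg Subtype.val (hI.trivial ⟨x, hx⟩ ⟨y, hy⟩)
    exact LieSubmodule.toSubmodule_injective hbot
  exact LieAlgebra.eq_zero_of_forall_mem_coatom_of_isKilling
    (mem_coatom_of_mem_frattiniSubalgebra h hf)

lemma eq_zero_of_mem_frattiniSubalgebra_of_irreducible (h : ∀ x : A, x * x = 0)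
    {V : Type*} [AddCommGroup V] [Module K V] [FiniteDimensional K V] [Nontrivial V]
    (ρ : A →ₗ[K] Module.End K V) (hρ : ∀ x y, ρ (x * y) = ρ x * ρ y - ρ y * ρ x)
    (hinj : ∀ x, ρ x = 0 → x = 0)
    (hirr : ∀ W : Submodule K V, (∀ a, ∀ w ∈ W, ρ a w ∈ W) → W ≠ ⊥ → W = ⊤)
    {f : A} (hf : f ∈ frattiniSubalgebra K A) : f = 0 := by
  let := lieRing h
  let := lieAlgebra (K := K) h
  let : LieRingModule A V :=
    { bracket := fun a w ↦ ρ a w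
      add_lie := fun a b w ↦ by
        change ρ (a + b) w = ρ a w + ρ b w
        rw [map_add, LinearMap.add_apply]
      lie_add := fun a v w ↦ map_add (ρ a) v w
      leibniz_lie := fun a b w ↦ by
        change ρ a (ρ b w) = ρ (a * b) w + ρ b (ρ a w)
        rw [hρ]
        simp }
  let : LieModule K A V :=
    { smul_lie := fun t a w ↦ by
        change ρ (t • a) w = t • ρ a w
        rw [map_smul, LinearMap.smul_apply]
      lie_smul := fun t a w ↦ map_smul (ρ a) t w }
  have hirr' : LieModule.IsIrreducible K A V := LieModule.IsIrreducible.mk fun N hN ↦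
    LieSubmodule.toSubmodule_injective (hirr N.toSubmodule (fun a w hw ↦ N.lie_mem hw)
      fun h0 ↦ hN (LieSubmodule.toSubmodule_injective h0))
  have hfaith : LieModule.IsFaithful K A V := by
    rw [LieModule.isFaithful_iff']
    intro x hx
    exact hinj x (LinearMap.ext hx)
  exact LieAlgebra.eq_zero_of_forall_mem_coatom_of_isIrreducible V
    (mem_coatom_of_mem_frattiniSubalgebra h hf)

end Lie

end Leibniz

namespace Leibniz

/-! ### The left annihilator -/

section Annihilators

variable {A : Type*} [NonUnitalNonAssocRing A] [IsLeibniz A]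

lemma mul_mul_eq_sub (x y z : A) : (x * y) * z = x * (y * z) - y * (x * z) :=
  eq_sub_of_add_eq (IsLeibniz.leibniz x y z).symm

/-- Symmetrized products, in particular squares, annihilate the algebra from the left. -/
lemma add_swap_mul_eq_zero (x y z : A) : (x * y + y * x) * z = 0 := by
  rw [add_mul, mul_mul_eq_sub, mul_mul_eq_sub]
  abel

variable {K : Type*} [Field K] [Module K A] [IsScalarTower K A A]

/-- The left annihilator of an algebra. -/
def leftAnnihilator (K A : Type*) [Field K] [NonUnitalNonAssocRing A] [Module K A]
    [IsScalarTower K A A] : Submodule K A where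
  carrier := {z | ∀ p, z * p = 0}
  add_mem' hx hy p := by rw [add_mul, hx, hy, add_zero]
  zero_mem' p := zero_mul p
  smul_mem' t x hx p := by rw [smul_mul_assoc, hx, smul_zero]

lemma isIdeal_leftAnnihilator : IsIdeal (leftAnnihilator K A) := by
  intro a x hx
  refine ⟨fun p ↦ ?_, fun p ↦ ?_⟩
  · rw [mul_mul_eq_sub, hx, hx, mul_zero, sub_zero]
  · rw [hx a, zero_mul]

end Annihilators

/-! ### Maximal subalgebras without nonzero ideals -/

section Primitive

variable {K A : Type*} [Field K] [NonUnitalNonAssocRing A] [Module K A]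
  [IsScalarTower K A A] [SMulCommClass K A A]

/-- A maximal subalgebra and an ideal it does not contain span the whole algebra. -/
lemma exists_add_of_isCoatom {M : NonUnitalSubalgebra K A} (hM : IsCoatom M) {B : Submodule K A}
    (hB : IsIdeal B) (hBM : ¬ B ≤ M.toSubmodule) (p : A) : ∃ m ∈ M, ∃ b ∈ B, p = m + b := by
  let S : NonUnitalSubalgebra K A :=
    { M.toSubmodule ⊔ B with
      mul_mem' := fun {x y} hx hy ↦ by
        obtain ⟨m, hm, b, hb, rfl⟩ := Submodule.mem_sup.mp hx
        obtain ⟨m', hm', b', hb', rfl⟩ := Submodule.mem_sup.mp hy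
        refine Submodule.mem_sup.mpr ⟨m * m', M.mul_mem hm hm', m * b' + b * (m' + b'),
          B.add_mem (hB m b' hb').1 (hB _ b hb).2, ?_⟩
        rw [add_mul, mul_add m, add_assoc] }
  have hMS : M < S := by
    refine lt_of_le_not_ge (fun x hx ↦ ?_) fun h ↦ hBM fun b hb ↦ h ?_
    · exact (le_sup_left : M.toSubmodule ≤ M.toSubmodule ⊔ B) hx
    · exact (le_sup_right : B ≤ M.toSubmodule ⊔ B) hb
  have hp : p ∈ S := hM.2 S hMS ▸ NonUnitalAlgebra.mem_top
  obtain ⟨m, hm, b, hb, h⟩ := Submodule.mem_sup.mp hp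
  exact ⟨m, hm, b, hb, h.symm⟩

/-- An abelian ideal meets a complementary core-free maximal subalgebra trivially, since the
intersection is an ideal. -/
lemma eq_zero_of_mem_of_mem {M : NonUnitalSubalgebra K A} (hM : IsCoatom M)
    (hcore : ∀ I : Submodule K A, IsIdeal I → I ≤ M.toSubmodule → I = ⊥) {B : Submodule K A}
    (hB : IsIdeal B) (hBB : ∀ x ∈ B, ∀ y ∈ B, x * y = 0) (hBM : ¬ B ≤ M.toSubmodule)
    {x : A} (hxM : x ∈ M) (hxB : x ∈ B) : x = 0 := by
  have hideal : IsIdeal (M.toSubmodule ⊓ B) := by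
    rintro p y ⟨hyM, hyB⟩
    obtain ⟨m, hm, b, hb, rfl⟩ := exists_add_of_isCoatom hM hB hBM p
    refine ⟨⟨?_, (hB _ y hyB).1⟩, ⟨?_, (hB _ y hyB).2⟩⟩
    · rw [add_mul, hBB b hb y hyB, add_zero]
      exact M.mul_mem hm hyM
    · rw [mul_add, hBB y hyB b hb, add_zero]
      exact M.mul_mem hyM hm
  have hx : x ∈ M.toSubmodule ⊓ B := ⟨hxM, hxB⟩
  rw [hcore _ hideal inf_le_left] at hx
  simpa using hx

variable [IsLeibniz A]

/-- The case of a minimal ideal `B` on which left and right multiplications agree up to sign: the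
unipotent automorphisms `1 - L_b` for `b ∈ B` force the Frattini subalgebra to centralize `B`, but
no nonzero ideal inside `M` does. -/
lemma eq_zero_of_mem_frattiniSubalgebra_of_symmetric {M : NonUnitalSubalgebra K A}
    (hM : IsCoatom M) (hcore : ∀ I : Submodule K A, IsIdeal I → I ≤ M.toSubmodule → I = ⊥)
    {B : Submodule K A} (hB : IsIdeal B) (hBB : ∀ x ∈ B, ∀ y ∈ B, x * y = 0)
    (hBM : ¬ B ≤ M.toSubmodule) (hsymm : ∀ b ∈ B, ∀ p, b * p + p * b = 0)
    {x : A} (hx : x ∈ frattiniSubalgebra K A) : x = 0 := by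
  have hBx : ∀ b ∈ B, b * x = 0 := by
    intro b hb
    let φ : A →ₙₐ[K] A :=
      { (LinearMap.id - LinearMap.mulLeft K b : A →ₗ[K] A) with
        map_zero' := by simp
        map_mul' := fun y z ↦ by
          change y * z - b * (y * z) = (y - b * y) * (z - b * z)
          rw [mul_sub, sub_mul, sub_mul, hBB _ (hB y b hb).2 _ (hB z b hb).2, IsLeibniz.leibniz]
          abel }
    have hφ (y : A) : φ y = y - b * y := rfl
    have hsurj : Function.Surjective φ := fun y ↦ ⟨y + b * y, by
      rw [hφ, mul_add, hBB b hb _ (hB y b hb).2]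
      abel⟩
    have h1 : φ x ∈ M := mem_frattiniSubalgebra.mp (map_mem_frattiniSubalgebra hsurj hx) M hM
    have h2 : x ∈ M := mem_frattiniSubalgebra.mp hx M hM
    have h3 : b * x ∈ M := by
      have := M.sub_mem h2 h1
      rwa [hφ, sub_sub_cancel] at this
    exact eq_zero_of_mem_of_mem hM hcore hB hBB hBM h3 (hB x b hb).2
  let C : Submodule K A :=
    { carrier := {z | z ∈ M ∧ ∀ b ∈ B, b * z = 0 ∧ z * b = 0}
      add_mem' := fun hy hz ↦ ⟨M.add_mem hy.1 hz.1, fun b hb ↦ ⟨by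
        rw [mul_add, (hy.2 b hb).1, (hz.2 b hb).1, add_zero], by
        rw [add_mul, (hy.2 b hb).2, (hz.2 b hb).2, add_zero]⟩⟩
      zero_mem' := ⟨M.zero_mem, fun b _ ↦ ⟨mul_zero b, zero_mul b⟩⟩
      smul_mem' := fun t y hy ↦ ⟨M.toSubmodule.smul_mem t hy.1, fun b hb ↦ ⟨by
        rw [mul_smul_comm, (hy.2 b hb).1, smul_zero], by
        rw [smul_mul_assoc, (hy.2 b hb).2, smul_zero]⟩⟩ }
  have hC : IsIdeal C := by
    rintro p y ⟨hyM, hy⟩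
    refine ⟨⟨?_, fun b hb ↦ ⟨?_, ?_⟩⟩, ⟨?_, fun b hb ↦ ⟨?_, ?_⟩⟩⟩
    · obtain ⟨m, hm, c, hc, rfl⟩ := exists_add_of_isCoatom hM hB hBM p
      rw [add_mul, (hy c hc).1, add_zero]
      exact M.mul_mem hm hyM
    · rw [IsLeibniz.leibniz, (hy _ (hB p b hb).2).1, (hy b hb).1, mul_zero, add_zero]
    · rw [mul_mul_eq_sub, (hy b hb).2, (hy _ (hB p b hb).1).2, mul_zero, sub_zero]
    · obtain ⟨m, hm, c, hc, rfl⟩ := exists_add_of_isCoatom hM hB hBM p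
      rw [mul_add, (hy c hc).2, add_zero]
      exact M.mul_mem hyM hm
    · rw [IsLeibniz.leibniz, (hy b hb).1, (hy _ (hB p b hb).2).2, zero_mul, add_zero]
    · rw [mul_mul_eq_sub, (hy b hb).2, (hy _ (hB p b hb).1).2, mul_zero, sub_zero]
  have hxC : x ∈ C := ⟨mem_frattiniSubalgebra.mp hx M hM, fun b hb ↦ ⟨hBx b hb, by
    have := hsymm b hb x
    rwa [hBx b hb, zero_add] at this⟩⟩
  rw [hcore C hC fun z hz ↦ hz.1] at hxC
  simpa using hxC

variable [CharZero K] [FiniteDimensional K A]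

/-- The case of a minimal ideal `B` with `BA = 0`: then `M` is a Lie algebra acting faithfully and
irreducibly on `B`, and `A` projects onto `M` along `B`. -/
lemma eq_zero_of_mem_frattiniSubalgebra_of_antisymmetric {M : NonUnitalSubalgebra K A}
    (hM : IsCoatom M) (hcore : ∀ I : Submodule K A, IsIdeal I → I ≤ M.toSubmodule → I = ⊥)
    {B : Submodule K A} (hB : IsIdeal B) (hBM : ¬ B ≤ M.toSubmodule)
    (hmin : ∀ I : Submodule K A, IsIdeal I → I ≤ B → I ≠ ⊥ → I = B)
    (hBA : ∀ b ∈ B, ∀ p : A, b * p = 0)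
    {x : A} (hx : x ∈ frattiniSubalgebra K A) : x = 0 := by
  have hBB : ∀ x ∈ B, ∀ y ∈ B, x * y = 0 := fun x hx y _ ↦ hBA x hx y
  have hdec := exists_add_of_isCoatom hM hB hBM
  have hdisj := fun {x : A} (hxM : x ∈ M) (hxB : x ∈ B) ↦
    eq_zero_of_mem_of_mem hM hcore hB hBB hBM hxM hxB
  -- The elements of `M` acting by zero on `B` form an ideal.
  have hfaith : ∀ m ∈ M, (∀ b ∈ B, m * b = 0) → m = 0 := by
    let Z : Submodule K A :=
      { carrier := {z | z ∈ M ∧ ∀ b ∈ B, z * b = 0}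
        add_mem' := fun hy hz ↦ ⟨M.add_mem hy.1 hz.1, fun b hb ↦ by
          rw [add_mul, hy.2 b hb, hz.2 b hb, add_zero]⟩
        zero_mem' := ⟨M.zero_mem, fun b _ ↦ zero_mul b⟩
        smul_mem' := fun t y hy ↦ ⟨M.toSubmodule.smul_mem t hy.1, fun b hb ↦ by
          rw [smul_mul_assoc, hy.2 b hb, smul_zero]⟩ }
    have hZ : IsIdeal Z := by
      rintro p y ⟨hyM, hy⟩
      obtain ⟨m, hm, c, hc, rfl⟩ := hdec p
      refine ⟨⟨?_, fun b hb ↦ ?_⟩, ⟨?_, fun b hb ↦ ?_⟩⟩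
      · rw [add_mul, hBA c hc, add_zero]
        exact M.mul_mem hm hyM
      · rw [mul_mul_eq_sub, hy b hb, hy _ (hB _ b hb).1, mul_zero, sub_zero]
      · rw [mul_add, hy c hc, add_zero]
        exact M.mul_mem hyM hm
      · rw [mul_mul_eq_sub, hy b hb, hy _ (hB _ b hb).1, mul_zero, sub_zero]
    intro m hm hmB
    have hmZ : m ∈ Z := ⟨hm, hmB⟩
    rw [hcore Z hZ fun z hz ↦ hz.1] at hmZ
    simpa using hmZ
  have hLeib : IsLeibniz M := ⟨fun a b c ↦ Subtype.ext (IsLeibniz.leibniz (a : A) b c)⟩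
  have hsq (m : M) : m * m = 0 := Subtype.ext (hfaith _ (M.mul_mem m.2 m.2) fun b _ ↦ by
    change ((m : A) * m) * b = 0
    rw [mul_mul_eq_sub, sub_self])
  have hcompl : IsCompl M.toSubmodule B := by
    refine ⟨Submodule.disjoint_def.mpr fun y hy hy' ↦ hdisj hy hy', codisjoint_iff.mpr ?_⟩
    rw [eq_top_iff]
    intro p _
    obtain ⟨m, hm, b, hb, rfl⟩ := hdec p
    exact Submodule.add_mem_sup hm hb
  -- The projection onto `M` along `B` is a homomorphism.
  let π : A →ₗ[K] M := Submodule.projectionOnto M.toSubmodule B hcompl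
  have hπM (m : M) : π m = m := Submodule.projectionOnto_apply_left hcompl m
  have hπB (b : A) (hb : b ∈ B) : π b = 0 :=
    (Submodule.projectionOnto_apply_eq_zero_iff hcompl).mpr hb
  let φ : A →ₙₐ[K] M :=
    { π with
      map_zero' := map_zero π
      map_mul' := fun p q ↦ by
        change π (p * q) = π p * π q
        obtain ⟨m, hm, b, hb, rfl⟩ := hdec p
        obtain ⟨m', hm', b', hb', rfl⟩ := hdec q
        rw [add_mul, hBA b hb, add_zero, mul_add, map_add, map_add, map_add, hπB _ (hB m b' hb').1,
          hπB b hb, hπB b' hb', add_zero, add_zero, add_zero]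
        have h1 := hπM ⟨m, hm⟩
        have h2 := hπM ⟨m', hm'⟩
        have h3 := hπM ⟨m * m', M.mul_mem hm hm'⟩
        rw [h1, h2, h3]
        rfl }
  have hφ : Function.Surjective φ := fun m ↦ ⟨m, hπM m⟩
  have hB0 : B ≠ ⊥ := fun h ↦ hBM (h ▸ bot_le)
  have : Nontrivial B := Submodule.nontrivial_iff_ne_bot.mpr hB0
  let ρ : M →ₗ[K] Module.End K B :=
    { toFun := fun m ↦ (LinearMap.mulLeft K (m : A)).restrict fun b hb ↦ (hB m b hb).1
      map_add' := fun m m' ↦ LinearMap.ext fun b ↦ Subtype.ext (add_mul (m : A) m' b)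
      map_smul' := fun t m ↦ LinearMap.ext fun b ↦ Subtype.ext (smul_mul_assoc t (m : A) (b : A)) }
  have hρ (m : M) (b : B) : ((ρ m b : B) : A) = m * b := rfl
  have : FiniteDimensional K M := inferInstanceAs (FiniteDimensional K M.toSubmodule)
  have hφx : φ x = 0 := by
    refine eq_zero_of_mem_frattiniSubalgebra_of_irreducible hsq ρ (fun m m' ↦ ?_) (fun m hm ↦ ?_)
      (fun W hW hW0 ↦ ?_) (map_mem_frattiniSubalgebra hφ hx)
    · exact LinearMap.ext fun b ↦ Subtype.ext (mul_mul_eq_sub (m : A) m' b)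
    · exact Subtype.ext (hfaith m m.2 fun b hb ↦
        congrArg Subtype.val (LinearMap.congr_fun hm ⟨b, hb⟩))
    · have hideal : IsIdeal (W.map B.subtype) := by
        rintro p _ ⟨w, hw, rfl⟩
        obtain ⟨m, hm, c, hc, rfl⟩ := hdec p
        refine ⟨⟨ρ ⟨m, hm⟩ w, hW _ w hw, ?_⟩, ?_⟩
        · change m * (w : A) = (m + c) * (w : A)
          rw [add_mul, hBA c hc, add_zero]
        · change (w : A) * (m + c) ∈ _
          rw [hBA w w.2]
          exact Submodule.zero_mem _
      have hmap := hmin _ hideal (Submodule.map_subtype_le B W) (fun h0 ↦ hW0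
        (Submodule.map_injective_of_injective B.injective_subtype
          (h0.trans (Submodule.map_bot _).symm)))
      rw [eq_top_iff]
      intro b _
      have hb : (b : A) ∈ W.map B.subtype := hmap.ge b.2
      obtain ⟨w, hw, hwb⟩ := hb
      rwa [← Subtype.ext hwb]
  have hxM : x ∈ M := mem_frattiniSubalgebra.mp hx M hM
  have h1 := hπM ⟨x, hxM⟩
  exact congrArg Subtype.val (h1.symm.trans hφx)

/-- If some maximal subalgebra contains no nonzero ideal, then the Frattini subalgebra is zero. -/
lemma eq_zero_of_mem_frattiniSubalgebra_of_coreFree {M : NonUnitalSubalgebra K A}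
    (hM : IsCoatom M) (hcore : ∀ I : Submodule K A, IsIdeal I → I ≤ M.toSubmodule → I = ⊥)
    {x : A} (hx : x ∈ frattiniSubalgebra K A) : x = 0 := by
  let T : Set (Submodule K A) := {B | IsIdeal B ∧ (∀ x ∈ B, ∀ y ∈ B, x * y = 0) ∧ B ≠ ⊥}
  by_cases hT : T.Nonempty
  · obtain ⟨B, ⟨hB, hBB, hB0⟩, hBmin⟩ := (wellFounded_lt (α := Submodule K A)).has_min T hT
    have hmin : ∀ I : Submodule K A, IsIdeal I → I ≤ B → I ≠ ⊥ → I = B := fun I hI hIB hI0 ↦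
      hIB.eq_of_not_lt (hBmin I ⟨hI, fun x hx y hy ↦ hBB x (hIB hx) y (hIB hy), hI0⟩)
    have hBM : ¬ B ≤ M.toSubmodule := fun h ↦ hB0 (hcore B hB h)
    by_cases hS : B ⊓ leftAnnihilator K A = ⊥
    · refine eq_zero_of_mem_frattiniSubalgebra_of_symmetric hM hcore hB hBB hBM (fun b hb p ↦ ?_) hx
      have h1 : b * p + p * b ∈ B ⊓ leftAnnihilator K A :=
        ⟨B.add_mem (hB p b hb).2 (hB p b hb).1, add_swap_mul_eq_zero b p⟩
      rw [hS] at h1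
      simpa using h1
    · have h1 := hmin _ (isIdeal_inf hB isIdeal_leftAnnihilator) inf_le_left hS
      exact eq_zero_of_mem_frattiniSubalgebra_of_antisymmetric hM hcore hB hBM hmin
        (fun b hb ↦ (inf_eq_left.mp h1 hb :)) hx
  · have hA : ∀ I : Submodule K A, IsIdeal I → (∀ x ∈ I, ∀ y ∈ I, x * y = 0) → I = ⊥ :=
      fun I hI hI' ↦ by_contra fun h0 ↦ hT ⟨I, hI, hI', h0⟩
    have hann := hA _ (isIdeal_leftAnnihilator (K := K) (A := A)) fun x hx y _ ↦ hx y
    refine eq_zero_of_mem_frattiniSubalgebra_of_no_abelian_ideals (fun y ↦ ?_) hA hx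
    have h1 : y * y ∈ leftAnnihilator K A := fun z ↦ by rw [mul_mul_eq_sub, sub_self]
    rw [hann] at h1
    simpa using h1

/-- The Frattini subalgebra is contained in the core of every maximal subalgebra. -/
lemma frattiniSubalgebra_le_core {M : NonUnitalSubalgebra K A} (hM : IsCoatom M) :
    (frattiniSubalgebra K A).toSubmodule ≤ core M := by
  intro x hx
  obtain ⟨P, _, _, _, _, φ, hφ, hker⟩ := exists_quotient (core M) (isIdeal_core M)
  have hLeib : IsLeibniz P := ⟨fun a b c ↦ by
    obtain ⟨a, rfl⟩ := hφ a
    obtain ⟨b, rfl⟩ := hφ b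
    obtain ⟨c, rfl⟩ := hφ c
    simp only [← map_mul, ← map_add, IsLeibniz.leibniz a b c]⟩
  have hfin : FiniteDimensional K P := Module.Finite.of_surjective (φ : A →ₗ[K] P) hφ
  have hmem (y : A) (hy : φ y ∈ M.map φ) : y ∈ M := by
    obtain ⟨m, hm, hmy⟩ := hy
    have h1 : y - m ∈ core M := by
      rw [← hker, map_sub, sub_eq_zero]
      exact hmy.symm
    simpa using M.add_mem (core_le M h1) hm
  have hcoatom : IsCoatom (M.map φ) := by
    refine ⟨fun h ↦ hM.1 ?_, fun S hS ↦ ?_⟩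
    · rw [eq_top_iff]
      exact fun y _ ↦ hmem y (h ▸ NonUnitalAlgebra.mem_top)
    · have hlt : M < S.comap φ := by
        refine lt_of_le_not_ge (fun m hm ↦ hS.le ⟨m, hm, rfl⟩) fun h ↦ hS.not_ge fun s hs ↦ ?_
        obtain ⟨y, rfl⟩ := hφ s
        exact ⟨y, h hs, rfl⟩
      rw [eq_top_iff]
      intro s _
      obtain ⟨y, rfl⟩ := hφ s
      have : y ∈ S.comap φ := hM.2 _ hlt ▸ NonUnitalAlgebra.mem_top
      exact this
  refine (hker x).mp (eq_zero_of_mem_frattiniSubalgebra_of_coreFree hcoatom (fun I hI hIM ↦ ?_)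
    (map_mem_frattiniSubalgebra hφ hx))
  have hle : I.comap (φ : A →ₗ[K] P) ≤ core M := by
    refine le_core (fun a y hy ↦ ?_) fun y hy ↦ hmem y (hIM hy)
    have hy : φ y ∈ I := hy
    refine ⟨?_, ?_⟩
    · change φ (a * y) ∈ I
      rw [map_mul]
      exact (hI _ _ hy).1
    · change φ (y * a) ∈ I
      rw [map_mul]
      exact (hI _ _ hy).2
  rw [eq_bot_iff]
  intro z hz
  obtain ⟨y, rfl⟩ := hφ z
  exact (hker y).mpr (hle hz)

end Primitive

end Leibniz

theorem mainTheorem9 (K : Type*) (A : Type*) [Field K] [CharZero K]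
    [NonUnitalNonAssocRing A] [Module K A] [IsScalarTower K A A] [SMulCommClass K A A]
    [FiniteDimensional K A] [IsLeibniz A] :
    Leibniz.IsIdeal (Leibniz.frattiniSubalgebra K A).toSubmodule ∧
      (Leibniz.frattiniSubalgebra K A).toSubmodule = Leibniz.frattiniIdeal K A := by
  have hideal : Leibniz.IsIdeal (Leibniz.frattiniSubalgebra K A).toSubmodule := fun a x hx ↦
    ⟨Leibniz.mem_frattiniSubalgebra.mpr fun M hM ↦ Leibniz.core_le M
      (Leibniz.isIdeal_core M a x (Leibniz.frattiniSubalgebra_le_core hM hx)).1,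
    Leibniz.mem_frattiniSubalgebra.mpr fun M hM ↦ Leibniz.core_le M
      (Leibniz.isIdeal_core M a x (Leibniz.frattiniSubalgebra_le_core hM hx)).2⟩
  exact ⟨hideal, le_antisymm ((Leibniz.isGreatest_frattiniIdeal K A).2 ⟨hideal, le_rfl⟩)
    (Leibniz.isGreatest_frattiniIdeal K A).1.2⟩
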